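/- Let $\varphi_k(t)=\sqrt{k+1/2}\,(2^kk!)^{-1}\frac{d^k}{dt^k}(t^2-1)^k$, $k=0,1,2,\dots$, be the Legendre polynomials orthonormal on $[-1,1]$, let $Q=[-1,1]^2$, $\langle f,\varphi_{k,j}\rangle=\int_Q f(t,\tau)\varphi_k(t)\varphi_j(\tau)\,d\tau\,dt$ for real $f\in L_2(Q)$, and let $$L^\mu_{s,2}=\Big\{f\in L_2(Q):\ \|f\|_{s,\mu}:=\Big(\sum_{k,j=0}^\infty \max\{1,kj\}^{s\mu}\,|\langle f,\varphi_{k,j}\rangle|^s\Big)^{1/s}\le 1\Big\}.$$ For an integer $r\ge1$ put $f^{(r,r)}=\sum_{k,j\ge r}\langle f,\varphi_{k,j}\rangle\,\varphi_k^{(r)}(t)\varphi_j^{(r)}(\tau)$. Let $C=C(Q)$ carry the uniform norm. For $0<\delta<1$ and $1\le p\le\infty$, a real family $\bar y=(y_{k,j})_{k,j\ge0}$ is called admissible for $f$ if $\|(\langle f,\varphi_{k,j}\rangle-y_{k,j})_{k,j}\|_{\ell_p}\le\delta$. For a finite set $\Omega\subset\{(k,j)\in\mathbb Z^2:\ k,j\ge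 r\}$ and an arbitrary map $\psi:\mathbb R^\Omega\to C$ let $$\varepsilon_\delta(\psi)=\sup_{f\in L^\mu_{s,2}}\ \sup_{\bar y\text{ admissible for }f}\big\|f^{(r,r)}-\psi\big((y_{k,j})_{(k,j)\in\Omega}\big)\big\|_C,\qquad R_{N,\delta}^{(r,r)}(L^\mu_{s,2},C,\ell_p)=\inf_{\operatorname{card}\Omega\le N}\ \inf_{\psi}\ \varepsilon_\delta(\psi).$$ Let $\Gamma_n=\{(k,j):\ kj\le rn-1,\ k,j=r,\dots,n-1\}$ and let $\mathcal D_n^{(r,r)}$ be the truncation method, which maps $(y_{k,j})_{(k,j)\in\Gamma_n}$ to $\sum_{(k,j)\in\Gamma_n}y_{k,j}\,\varphi_k^{(r)}(t)\varphi_j^{(r)}(\tau)$. **Theorem.** Let $r\ge1$ be an integer, $1\le s<\infty$, $\mu>2r-1/s+3/2$ and $1\le p\le\infty$. Then for every $f\in L^\mu_{s,2}$ the series for $f^{(r,r)}$ converges unconditionally in $C(Q)$. Moreover, for $0<\delta<1$ and integers $N\ge2$ with $N\asymp\big(\delta^{-1}\ln^{\mu}\frac1\delta\big)^{\frac1{\mu-1/p+1/s}}$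 it holds $$N^{-\mu+2r-1/s+3/2}\ \preceq\ R_{N,\delta}^{(r,r)}(L^\mu_{s,2},C,\ell_p)\ \preceq\ N^{-\mu+2r-1/s+3/2}\ln^{\mu-2r+1/2}N$$ and, equivalently, $$\Big(\delta\ln^{-\mu}\tfrac1\delta\Big)^{\frac{\mu-2r+1/s-3/2}{\mu-1/p+1/s}}\ \preceq\ R_{N,\delta}^{(r,r)}(L^\mu_{s,2},C,\ell_p)\ \preceq\ \Big(\delta\ln^{1/s-1/p}\tfrac1\delta\Big)^{\frac{\mu-2r+1/s-3/2}{\mu-1/p+1/s}}\ln^{2-1/s}\tfrac1\delta .$$ The upper bounds are realized by $\mathcal D_n^{(r,r)}$ for $n\asymp\big(\delta^{-1}\ln^{1/p-1/s}\frac1\delta\big)^{\frac1{\mu-1/p+1/s}}$: for every such choice of $n$ the error $\varepsilon_\delta(\mathcal D_n^{(r,r)})$ satisfies both upper bounds, and $n$ of this order can be chosen with $\operatorname{card}\Gamma_n\le N$. Here $a\preceq b$ means $a\le cb$ with a constant $c>0$, and $a\asymp b$ means $a\preceq b$ and $b\preceq a$. The constants in the conclusions depend only on $r,s,\mu,p$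 and on the constants in the hypotheses $N\asymp\cdots$ and (for the error of $\mathcal D_n^{(r,r)}$) $n\asymp\cdots$; they do not depend on $\delta,N,n$. -/

import Mathlib

open MeasureTheory
open scoped ENNReal Polynomial

noncomputable section

namespace GalerkinDiff

/-- The Legendre polynomials orthonormal on `[-1, 1]`, by Rodrigues' formula:
`φ_k(t) = √(k + 1/2) (2^k k!)⁻¹ d^k/dt^k (t² - 1)^k`. -/
def legendre (k : ℕ) : ℝ[X] :=
  Polynomial.C (Real.sqrt (k + 1 / 2) * ((2 : ℝ) ^ k * (Nat.factorial k : ℝ))⁻¹) *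
    Polynomial.derivative^[k] ((Polynomial.X ^ 2 - 1) ^ k)

/-- The square `Q = [-1, 1]²`. -/
abbrev Q : Set (ℝ × ℝ) := Set.Icc (-1, -1) (1, 1)

/-- The Fourier-Legendre coefficient `⟨f, φ_{k,j}⟩` on `Q`. -/
def coeff (f : ℝ × ℝ → ℝ) (q : ℕ × ℕ) : ℝ :=
  ∫ x in Q, f x * ((legendre q.1).eval x.1 * (legendre q.2).eval x.2)

/-- The norm `‖f‖_{s,μ} = (∑_{k,j} max(1, k j)^{s μ} |⟨f, φ_{k,j}⟩|^s)^{1/s}`, which may be `∞`. -/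
def weightedNorm (s μ : ℝ) (f : ℝ × ℝ → ℝ) : ℝ≥0∞ :=
  (∑' q : ℕ × ℕ,
    ENNReal.ofReal ((max 1 ((q.1 * q.2 : ℕ) : ℝ)) ^ (s * μ) * |coeff f q| ^ s)) ^ (1 / s)

/-- The class `L^μ_{s,2}`: square-integrable functions on `Q` with `‖f‖_{s,μ} ≤ 1`. -/
def unitClass (s μ : ℝ) : Set (ℝ × ℝ → ℝ) :=
  {f | MemLp f 2 (volume.restrict Q) ∧ weightedNorm s μ f ≤ 1}

/-- The function `(t, τ) ↦ φ_k^{(r)}(t) φ_j^{(r)}(τ)` as an element of `C(Q)`. -/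
def basisDeriv (r : ℕ) (q : ℕ × ℕ) : C(Q, ℝ) where
  toFun x := (Polynomial.derivative^[r] (legendre q.1)).eval (x : ℝ × ℝ).1 *
    (Polynomial.derivative^[r] (legendre q.2)).eval (x : ℝ × ℝ).2
  continuous_toFun := by fun_prop

/-- The terms `⟨f, φ_{k,j}⟩ φ_k^{(r)} φ_j^{(r)}`, `k, j ≥ r`, of the series for `f^{(r,r)}`,
indexed by `(k - r, j - r)`. -/
def derivTerm (r : ℕ) (f : ℝ × ℝ → ℝ) (q : ℕ × ℕ) : C(Q, ℝ) :=
  coeff f (r + q.1, r + q.2) • basisDeriv r (r + q.1, r + q.2)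

/-- The mixed derivative `f^{(r,r)}`, the sum of its series in `C(Q)`. -/
def mixedDeriv (r : ℕ) (f : ℝ × ℝ → ℝ) : C(Q, ℝ) :=
  ∑' q : ℕ × ℕ, derivTerm r f q

/-- `y` is a family of perturbed Fourier-Legendre coefficients of `f`, of error at most `δ`
in the metric of `ℓ_p`. -/
def IsPerturbation (p : ℝ≥0∞) (δ : ℝ) (f : ℝ × ℝ → ℝ) (y : ℕ × ℕ → ℝ) : Prop :=
  ∃ ξ : lp (fun _ : ℕ × ℕ => ℝ) p, (∀ q, ξ q = coeff f q - y q) ∧ ‖ξ‖ ≤ δ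

/-- The error `ε_δ(L^μ_{s,2}, ψ, C, ℓ_p)` of an algorithm `ψ` that uses the perturbed coefficients
with indices in the finite set `Ω`. -/
def algError (r : ℕ) (s μ : ℝ) (p : ℝ≥0∞) (δ : ℝ) (Ω : Finset (ℕ × ℕ))
    (ψ : (Ω → ℝ) → C(Q, ℝ)) : ℝ≥0∞ :=
  ⨆ f ∈ unitClass s μ, ⨆ (y : ℕ × ℕ → ℝ) (_ : IsPerturbation p δ f y),
    ‖mixedDeriv r f - ψ (fun q => y q)‖ₑ

/-- The minimal radius of Galerkin information `R_{N,δ}^{(r,r)}(L^μ_{s,2}, C, ℓ_p)`. -/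
def minimalRadius (r : ℕ) (s μ : ℝ) (p : ℝ≥0∞) (N : ℕ) (δ : ℝ) : ℝ≥0∞ :=
  ⨅ (Ω : Finset (ℕ × ℕ)) (_ : (∀ q ∈ Ω, r ≤ q.1 ∧ r ≤ q.2) ∧ Ω.card ≤ N)
    (ψ : (Ω → ℝ) → C(Q, ℝ)), algError r s μ p δ Ω ψ

/-- The hyperbolic cross `Γ_n = {(k, j) : k j ≤ r n - 1, k, j = r, …, n - 1}`. -/
def hyperbolicCross (r n : ℕ) : Finset (ℕ × ℕ) :=
  (Finset.Ico r n ×ˢ Finset.Ico r n).filter (fun q => q.1 * q.2 + 1 ≤ r * n)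

/-- The truncation method `D_n^{(r,r)}`. -/
def truncation (r n : ℕ) (y : hyperbolicCross r n → ℝ) : C(Q, ℝ) :=
  ∑ q : hyperbolicCross r n, y q • basisDeriv r q

/-- `(δ⁻¹ ln^μ(1/δ))^{1/(μ - 1/p + 1/s)}`. -/
def infoScale (s μ : ℝ) (p : ℝ≥0∞) (δ : ℝ) : ℝ :=
  (δ⁻¹ * Real.log (1 / δ) ^ μ) ^ (1 / (μ - (1 / p).toReal + 1 / s))

/-- `(δ⁻¹ ln^{1/p - 1/s}(1/δ))^{1/(μ - 1/p + 1/s)}`. -/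
def degreeScale (s μ : ℝ) (p : ℝ≥0∞) (δ : ℝ) : ℝ :=
  (δ⁻¹ * Real.log (1 / δ) ^ ((1 / p).toReal - 1 / s)) ^ (1 / (μ - (1 / p).toReal + 1 / s))

/-- `(δ ln^{-μ}(1/δ))^{(μ - 2r + 1/s - 3/2)/(μ - 1/p + 1/s)}`. -/
def lowerRate (r : ℕ) (s μ : ℝ) (p : ℝ≥0∞) (δ : ℝ) : ℝ :=
  (δ * Real.log (1 / δ) ^ (-μ)) ^ ((μ - 2 * r + 1 / s - 3 / 2) / (μ - (1 / p).toReal + 1 / s))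

/-- `(δ ln^{1/s - 1/p}(1/δ))^{(μ - 2r + 1/s - 3/2)/(μ - 1/p + 1/s)} ln^{2 - 1/s}(1/δ)`. -/
def upperRate (r : ℕ) (s μ : ℝ) (p : ℝ≥0∞) (δ : ℝ) : ℝ :=
  (δ * Real.log (1 / δ) ^ (1 / s - (1 / p).toReal)) ^
      ((μ - 2 * r + 1 / s - 3 / 2) / (μ - (1 / p).toReal + 1 / s)) *
    Real.log (1 / δ) ^ (2 - 1 / s)

end GalerkinDiff

end

/-! Everything rests on the size of `φ_k^{(r)}`: on `[-1, 1]` its modulus is largest at `t = 1`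
(`abs_eval_rodrigues_le`), where it is comparable to `k^ν`, `ν = 2r + 1/2`. Hence `φ_k^{(r)}
φ_j^{(r)}` has uniform norm at most `4 (kj)^ν`, a bound in the product `kj` alone, which makes
hyperbolic crosses the natural index sets.

Upper bound. Put `X = rn`, `α = μ - 2r + 1/s - 3/2 > 0`, `L = ln (1/δ)`. The error of truncation is
a tail over `kj ≥ X` plus the noise on the cross. Splitting the tail into dyadic blocks `kj ~ Y` of
`O(Y ln Y)` pairs and using Hölder's inequality against the weight of the class bounds it by a
multiple of `X^{-α} (1 + ln X)` (`exists_sum_tail_le`). Hölder's inequality in `ℓ_p` bounds the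
noise by a multiple of `δ X^ν (X (1 + ln X))^{1 - 1/p}`. If `D` is the `degreeScale`, then `δ D^{μ -
1/p + 1/s} = L^{1/p - 1/s}`, so for `n ≍ D` the two bounds are of orders `D^{-α} L` and `D^{-α} L^{1
- 1/s}`, both within `upperRate`. Since `infoScale = D L` and a cross of order about `D` has `O(D
L)` points, it fits into `N` coefficients.

Lower bound. The noise plays no role. If `Ω` has at most `N` points, the row `k = r` has at least
`N` unused indices `j = r + i` with `N ≤ i < 3N`. Equal coefficients of order `N^{-μ - 1/s}` there
give an `f` of the class whose data on `Ω` vanish, so `f` and `-f` are indistinguishable and the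
error is at least `‖f^{(r,r)}‖`. At the corner `(1, 1)` all terms are positive and add up to order
`N · N^{-μ - 1/s} · N^ν` (`exists_le_minimalRadius`). -/

namespace GalerkinDiff

/-! ### ### Differential equation and extremal values of the Legendre derivatives -/

section Legendre

open Polynomial

/-- The iterated derivatives `d^m/dt^m (t² - 1)^k` of Rodrigues' formula. -/
noncomputable def rodrigues (k m : ℕ) : ℝ[X] := derivative^[m] ((X ^ 2 - 1) ^ k)

lemma derivative_rodrigues (k m : ℕ) : derivative (rodrigues k m) = rodrigues k (m + 1) := by
  rw [rodrigues, rodrigues, Function.iterate_succ_apply']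

/-- Logarithmic derivative of `(t² - 1)^k`; repeated differentiation of this relation yields the
second-order equation. -/
lemma rodrigues_first_order (k : ℕ) :
    ((X : ℝ[X]) ^ 2 - 1) * rodrigues k 1 = 2 * (k : ℝ[X]) * X * rodrigues k 0 := by
  rcases k with _ | k
  · simp [rodrigues]
  · simp only [rodrigues, Function.iterate_one, Function.iterate_zero, id, derivative_pow,
      derivative_sub, derivative_one, derivative_X, Nat.add_sub_cancel]
    push_cast
    simp only [map_add, map_natCast, map_one, map_ofNat]
    ring

/-- The differential equation of the derivatives of the Legendre polynomials. -/
lemma rodrigues_ode (k m : ℕ) :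
    ((X : ℝ[X]) ^ 2 - 1) * rodrigues k (m + 2) + 2 * ((m : ℝ[X]) + 1 - (k : ℝ[X])) * X * rodrigues k (m + 1)
      + ((m : ℝ[X]) + 1) * ((m : ℝ[X]) - 2 * (k : ℝ[X])) * rodrigues k m = 0 := by
  induction m with
  | zero =>
    have h := congrArg derivative (rodrigues_first_order k)
    simp only [derivative_mul, derivative_sub, derivative_X_pow, derivative_one, derivative_X,
      derivative_natCast, derivative_ofNat, derivative_rodrigues] at h
    push_cast at h ⊢
    simp only [map_ofNat] at h
    linear_combination h
  | succ m ih =>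
    have h := congrArg derivative ih
    simp only [derivative_mul, derivative_add, derivative_sub, derivative_X_pow, derivative_one,
      derivative_X, derivative_natCast, derivative_ofNat, derivative_rodrigues,
      derivative_zero] at h
    push_cast at h ⊢
    simp only [map_ofNat] at h
    linear_combination h

/-- At `t = ±1` the leading coefficient vanishes, so the equation turns into a recursion in `i` for
the endpoint values. -/
lemma rodrigues_ode_eval (k i : ℕ) (t : ℝ) :
    (t ^ 2 - 1) * (rodrigues k (k + i + 2)).eval t
      + 2 * ((i : ℝ) + 1) * t * (rodrigues k (k + i + 1)).eval t
      = ((k : ℝ) + i + 1) * (k - i) * (rodrigues k (k + i)).eval t := by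
  have h := congrArg (eval t) (rodrigues_ode k (k + i))
  simp only [eval_add, eval_mul, eval_sub, eval_pow, eval_X, eval_one, eval_natCast, eval_ofNat,
    eval_zero, Nat.cast_add] at h
  linear_combination h

/-- In the Leibniz rule for `(X - 1)^k (X + 1)^k` only the term in which all `k` derivatives fall on
`(X - 1)^k` survives at `1`. -/
lemma eval_one_rodrigues_self (k : ℕ) :
    (rodrigues k k).eval 1 = (k.factorial : ℝ) * 2 ^ k := by
  have h := aeval_iterate_derivative_self (R := ℝ) (A := ℝ) ((X ^ 2 - 1 : ℝ[X]) ^ k) k 1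
    (p' := (X + 1) ^ k) (by
      rw [Algebra.algebraMap_self, map_id, ← mul_pow, map_one]; congr 1; ring)
  rw [coe_aeval_eq_eval] at h
  rw [rodrigues, h]
  simp only [eval_pow, eval_add, eval_X, eval_one, nsmul_eq_mul]
  norm_num

lemma eval_neg_one_rodrigues_self (k : ℕ) :
    (rodrigues k k).eval (-1) = (k.factorial : ℝ) * (-2) ^ k := by
  have h := aeval_iterate_derivative_self (R := ℝ) (A := ℝ) ((X ^ 2 - 1 : ℝ[X]) ^ k) k (-1)
    (p' := (X - 1) ^ k) (by
      rw [Algebra.algebraMap_self, map_id, ← mul_pow, map_neg, map_one]; congr 1; ring)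
  rw [coe_aeval_eq_eval] at h
  rw [rodrigues, h]
  simp only [eval_pow, eval_sub, eval_X, eval_one, nsmul_eq_mul]
  norm_num

lemma eval_one_rodrigues (k i : ℕ) :
    (rodrigues k (k + i)).eval 1 = (k.factorial : ℝ) * 2 ^ k *
      ∏ l ∈ Finset.range i, (((k : ℝ) + l + 1) * (k - l) / (2 * (l + 1))) := by
  induction i with
  | zero => simpa using eval_one_rodrigues_self k
  | succ i ih =>
    have h := rodrigues_ode_eval k i 1
    rw [Finset.prod_range_succ, ← mul_assoc, ← ih]
    have : (i : ℝ) + 1 ≠ 0 := by positivity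
    rw [← add_assoc]
    field_simp
    linear_combination h

/-- The endpoint recursions at `1` and `-1` differ only in sign, so parity of the polynomials is not
needed. -/
lemma abs_eval_neg_one_rodrigues (k i : ℕ) :
    |(rodrigues k (k + i)).eval (-1)| = |(rodrigues k (k + i)).eval 1| := by
  induction i with
  | zero =>
    simp only [add_zero, eval_one_rodrigues_self, eval_neg_one_rodrigues_self, abs_mul, abs_pow,
      abs_neg]
  | succ i ih =>
    have h := congrArg abs (rodrigues_ode_eval k i 1)
    have h' := congrArg abs (rodrigues_ode_eval k i (-1))
    rw [abs_mul _ (eval _ _), ih, ← abs_mul, ← h] at h'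
    norm_num [abs_mul] at h'
    have h0 : |(i : ℝ) + 1| ≠ 0 := by positivity
    have h1 : (i : ℝ) + 1 ≠ 0 := by positivity
    simpa [h0, h1, add_assoc] using h'

/-- Sonine's argument: on `[-1, 1]` a derivative of a Legendre polynomial is largest at `1`. -/
lemma abs_eval_rodrigues_le {k i : ℕ} (hi : i ≤ k) {t : ℝ} (ht : t ∈ Set.Icc (-1 : ℝ) 1) :
    |(rodrigues k (k + i)).eval t| ≤ |(rodrigues k (k + i)).eval 1| := by
  rcases hi.eq_or_lt with rfl | hlt
  -- For `i = k` the factor `k - i` in Sonine's function vanishes and the argument below breaks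
  -- down, but then the polynomial is constant.
  · have hdeg : (rodrigues i (i + i)).natDegree = 0 := by
      have h1 := natDegree_iterate_derivative ((X ^ 2 - 1 : ℝ[X]) ^ i) (i + i)
      have h2 : ((X ^ 2 - 1 : ℝ[X]) ^ i).natDegree ≤ i * 2 :=
        natDegree_pow_le_of_le i (by compute_degree)
      rw [rodrigues]; omega
    rw [eq_C_of_natDegree_eq_zero hdeg, eval_C, eval_C]
  -- With `y` the polynomial in question and `λ = (k + i + 1)(k - i)`, this is `F = λ y² + (1 - x²)
  -- y'²`. The differential equation gives `F' = (4i + 2) x y'²`, so `F` falls on `[-1, 0]` and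
  -- rises on `[0, 1]`. It dominates `λ y²`, with equality at `±1`.
  set F : ℝ[X] := C (((k : ℝ) + i + 1) * (k - i)) * rodrigues k (k + i) ^ 2
    + (1 - X ^ 2) * rodrigues k (k + i + 1) ^ 2 with hF
  have hlam : 0 < ((k : ℝ) + i + 1) * (k - i) := by
    have : (i : ℝ) < k := by exact_mod_cast hlt
    have : (0 : ℝ) < k - i := by linarith
    positivity
  have hderiv : ∀ x : ℝ, deriv (fun y => F.eval y) x
      = (4 * i + 2) * x * (rodrigues k (k + i + 1)).eval x ^ 2 := by
    intro x
    rw [Polynomial.deriv, hF]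
    simp only [derivative_add, derivative_sub, derivative_mul, derivative_pow, derivative_C,
      derivative_one, derivative_X, derivative_rodrigues, eval_add, eval_mul, eval_sub, eval_pow,
      eval_C, eval_X, eval_one, eval_zero]
    norm_num
    linear_combination (-2 * (rodrigues k (k + i + 1)).eval x) * rodrigues_ode_eval k i x
  have hle : ∀ x ∈ Set.Icc (-1 : ℝ) 1,
      ((k : ℝ) + i + 1) * (k - i) * (rodrigues k (k + i)).eval x ^ 2 ≤ F.eval x := by
    intro x hx
    have : 0 ≤ (1 - x ^ 2) * (rodrigues k (k + i + 1)).eval x ^ 2 :=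
      mul_nonneg (by nlinarith [hx.1, hx.2]) (sq_nonneg _)
    simp only [hF, eval_add, eval_mul, eval_sub, eval_pow, eval_C, eval_X, eval_one]
    linarith
  have hend : F.eval (-1) = F.eval 1 := by
    have h := congrArg (· ^ 2) (abs_eval_neg_one_rodrigues k i)
    simp only [sq_abs] at h
    simp [hF, h]
  have hF1 : F.eval 1 = ((k : ℝ) + i + 1) * (k - i) * (rodrigues k (k + i)).eval 1 ^ 2 := by
    simp [hF]
  have hmax : F.eval t ≤ F.eval 1 := by
    rcases le_total 0 t with h0 | h0
    · have hm : MonotoneOn (fun y => F.eval y) (Set.Icc 0 1) := by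
        refine monotoneOn_of_deriv_nonneg (convex_Icc _ _) F.continuous.continuousOn
          F.differentiable.differentiableOn fun x hx => ?_
        rw [interior_Icc] at hx
        rw [hderiv]
        have := hx.1.le
        positivity
      exact hm ⟨h0, ht.2⟩ ⟨zero_le_one, le_rfl⟩ ht.2
    · have hm : AntitoneOn (fun y => F.eval y) (Set.Icc (-1) 0) := by
        refine antitoneOn_of_deriv_nonpos (convex_Icc _ _) F.continuous.continuousOn
          F.differentiable.differentiableOn fun x hx => ?_
        rw [interior_Icc] at hx
        rw [hderiv]
        have := hx.2.le
        exact mul_nonpos_of_nonpos_of_nonneg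
          (mul_nonpos_of_nonneg_of_nonpos (by positivity) this) (sq_nonneg _)
      rw [← hend]
      exact hm ⟨le_rfl, by norm_num⟩ ⟨ht.1, h0⟩ ht.1
  have := (hle t ht).trans (hmax.trans hF1.le)
  exact sq_le_sq.1 (le_of_mul_le_mul_left this hlam)

/-! ### Values of the derivatives of the Legendre polynomials -/

lemma iterate_derivative_legendre (r k : ℕ) : derivative^[r] (legendre k) =
    C (Real.sqrt (k + 1 / 2) * ((2 : ℝ) ^ k * (k.factorial : ℝ))⁻¹) * rodrigues k (k + r) := by
  rw [legendre, iterate_derivative_C_mul, rodrigues, ← Function.iterate_add_apply, add_comm r k]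

lemma eval_one_iterate_derivative_legendre (r k : ℕ) :
    (derivative^[r] (legendre k)).eval 1 = Real.sqrt (k + 1 / 2) *
      ∏ l ∈ Finset.range r, (((k : ℝ) + l + 1) * (k - l) / (2 * (l + 1))) := by
  rw [iterate_derivative_legendre, eval_mul, eval_C, eval_one_rodrigues]
  have : (k.factorial : ℝ) ≠ 0 := by positivity
  field_simp

lemma eval_one_iterate_derivative_legendre_le {r k : ℕ} (hr : 1 ≤ r) (hk : r ≤ k) :
    (derivative^[r] (legendre k)).eval 1 ≤ 2 * (k : ℝ) ^ (2 * (r : ℝ) + 1 / 2) := by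
  rw [eval_one_iterate_derivative_legendre]
  have hk1 : (1 : ℝ) ≤ k := by exact_mod_cast hr.trans hk
  have hprod : ∏ l ∈ Finset.range r, (((k : ℝ) + l + 1) * (k - l) / (2 * (l + 1)))
      ≤ ∏ _l ∈ Finset.range r, (k : ℝ) ^ 2 := by
    refine Finset.prod_le_prod (fun l hl => ?_) fun l hl => ?_ <;>
    · have hl' : (l : ℝ) + 1 ≤ k := by
        have := Finset.mem_range.1 hl
        exact_mod_cast (by omega : l + 1 ≤ k)
      have hl0 : (0 : ℝ) ≤ l := by positivity
      have : (0 : ℝ) ≤ k - l := by linarith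
      first
      | positivity
      | rw [div_le_iff₀ (by positivity)]
        nlinarith [mul_nonneg hl0 (sq_nonneg (k : ℝ)), mul_nonneg this hl0]
  have hsqrt : Real.sqrt (k + 1 / 2) ≤ 2 * (k : ℝ) ^ (1 / 2 : ℝ) := by
    rw [← Real.sqrt_eq_rpow, ← Real.sqrt_sq (zero_le_two (α := ℝ)), ← Real.sqrt_mul (by norm_num)]
    exact Real.sqrt_le_sqrt (by linarith)
  calc _ ≤ 2 * (k : ℝ) ^ (1 / 2 : ℝ) * ∏ _l ∈ Finset.range r, (k : ℝ) ^ 2 := by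
        refine mul_le_mul hsqrt hprod (Finset.prod_nonneg fun l hl => ?_) (by positivity)
        have hl' : (l : ℝ) ≤ k := by exact_mod_cast ((Finset.mem_range.1 hl).le.trans hk)
        have : (0 : ℝ) ≤ k - l := by linarith
        positivity
    _ = _ := by
        rw [Finset.prod_const, Finset.card_range, ← pow_mul, add_comm (2 * (r : ℝ)),
          Real.rpow_add (by positivity), mul_assoc]
        congr 2
        rw [← Real.rpow_natCast]; push_cast; rfl

lemma le_eval_one_iterate_derivative_legendre {r k : ℕ} (hr : 1 ≤ r) (hk : r ≤ k) :
    (1 / (2 * (r : ℝ) ^ 2)) ^ r * (k : ℝ) ^ (2 * (r : ℝ) + 1 / 2)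
      ≤ (derivative^[r] (legendre k)).eval 1 := by
  rw [eval_one_iterate_derivative_legendre]
  have hr1 : (1 : ℝ) ≤ r := by exact_mod_cast hr
  have hkr : (r : ℝ) ≤ k := by exact_mod_cast hk
  have hprod : ∏ _l ∈ Finset.range r, (1 / (2 * (r : ℝ) ^ 2) * (k : ℝ) ^ 2)
      ≤ ∏ l ∈ Finset.range r, (((k : ℝ) + l + 1) * (k - l) / (2 * (l + 1))) := by
    refine Finset.prod_le_prod (fun l hl => by positivity) fun l hl => ?_
    have hl' : (l : ℝ) + 1 ≤ r := by
      have := Finset.mem_range.1 hl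
      exact_mod_cast (by omega : l + 1 ≤ r)
    have hl0 : (0 : ℝ) ≤ l := by positivity
    -- As `l ≤ r - 1`, it suffices that `k - (r - 1) ≥ k / r`, which amounts to `k ≥ r` when `r >
    -- 1`.
    have h1 : (k : ℝ) / r ≤ k - l := by
      rw [div_le_iff₀ (by linarith)]
      nlinarith [mul_nonneg (sub_nonneg.2 hkr) (by linarith : (0 : ℝ) ≤ r - 1),
        mul_nonneg (by linarith : (0 : ℝ) ≤ (r : ℝ) - 1 - l) (by linarith : (0 : ℝ) ≤ r)]
    calc 1 / (2 * (r : ℝ) ^ 2) * (k : ℝ) ^ 2 = k * (k / r) / (2 * r) := by field_simp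
      _ ≤ _ := by
        have h0 : (0 : ℝ) ≤ k - l := by linarith
        exact div_le_div₀ (by positivity) (mul_le_mul (by linarith) h1 (by positivity)
          (by positivity)) (by positivity) (by linarith)
  have hsqrt : (k : ℝ) ^ (1 / 2 : ℝ) ≤ Real.sqrt (k + 1 / 2) := by
    rw [← Real.sqrt_eq_rpow]
    exact Real.sqrt_le_sqrt (by linarith)
  calc _ = (k : ℝ) ^ (1 / 2 : ℝ) * ∏ _l ∈ Finset.range r, (1 / (2 * (r : ℝ) ^ 2) * (k : ℝ) ^ 2) := by
        rw [Finset.prod_const, Finset.card_range, mul_pow, ← pow_mul, add_comm (2 * (r : ℝ)),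
          Real.rpow_add (by linarith), mul_left_comm]
        congr 2
        rw [← Real.rpow_natCast]; push_cast; rfl
    _ ≤ _ := by gcongr

lemma abs_eval_iterate_derivative_legendre_le {r k : ℕ} (hr : 1 ≤ r) (hk : r ≤ k) {t : ℝ}
    (ht : t ∈ Set.Icc (-1 : ℝ) 1) :
    |(derivative^[r] (legendre k)).eval t| ≤ 2 * (k : ℝ) ^ (2 * (r : ℝ) + 1 / 2) := by
  refine le_trans ?_ (eval_one_iterate_derivative_legendre_le hr hk)
  have hpos : 0 ≤ (derivative^[r] (legendre k)).eval 1 :=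
    le_trans (by positivity) (le_eval_one_iterate_derivative_legendre hr hk)
  rw [← abs_of_nonneg hpos]
  simp only [iterate_derivative_legendre, eval_mul, eval_C, abs_mul]
  exact mul_le_mul_of_nonneg_left (abs_eval_rodrigues_le hk ht) (by positivity)

lemma norm_basisDeriv_le {r : ℕ} (hr : 1 ≤ r) {q : ℕ × ℕ} (h1 : r ≤ q.1) (h2 : r ≤ q.2) :
    ‖basisDeriv r q‖ ≤ 4 * ((q.1 * q.2 : ℕ) : ℝ) ^ (2 * (r : ℝ) + 1 / 2) := by
  refine (ContinuousMap.norm_le _ (by positivity)).2 fun x => ?_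
  have hx := x.2
  have e : basisDeriv r q x = (derivative^[r] (legendre q.1)).eval (x : ℝ × ℝ).1 *
    (derivative^[r] (legendre q.2)).eval (x : ℝ × ℝ).2 := rfl
  rw [e, Real.norm_eq_abs, abs_mul, Nat.cast_mul,
    Real.mul_rpow (by positivity) (by positivity)]
  calc _ ≤ (2 * (q.1 : ℝ) ^ (2 * (r : ℝ) + 1 / 2)) * (2 * (q.2 : ℝ) ^ (2 * (r : ℝ) + 1 / 2)) := by
        gcongr
        · exact abs_eval_iterate_derivative_legendre_le hr h1 ⟨hx.1.1, hx.2.1⟩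
        · exact abs_eval_iterate_derivative_legendre_le hr h2 ⟨hx.1.2, hx.2.2⟩
    _ = _ := by ring

/-! ### Orthonormality -/

lemma eval_rodrigues_eq_zero {k i : ℕ} (hi : i < k) {t : ℝ} (ht : t ^ 2 = 1) :
    (rodrigues k i).eval t = 0 := by
  have hdvd := pow_sub_dvd_iterate_derivative_of_pow_dvd i
    (dvd_refl ((X ^ 2 - 1 : ℝ[X]) ^ k))
  obtain ⟨g, hg⟩ := hdvd
  rw [rodrigues, hg, eval_mul, eval_pow]
  simp [ht, Nat.sub_ne_zero_of_lt hi]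

lemma integral_derivative_mul (p q : ℝ[X]) :
    ∫ t in (-1 : ℝ)..1, (derivative p).eval t * q.eval t =
      p.eval 1 * q.eval 1 - p.eval (-1) * q.eval (-1)
        - ∫ t in (-1 : ℝ)..1, p.eval t * (derivative q).eval t := by
  rw [intervalIntegral.integral_mul_deriv_eq_deriv_mul (fun x _ => p.hasDerivAt x)
    (fun x _ => q.hasDerivAt x) ((derivative p).continuous.intervalIntegrable _ _)
    ((derivative q).continuous.intervalIntegrable _ _)]
  ring

/-- Integration by parts `i` times moves all derivatives onto `q`; the boundary terms vanish because
a factor `t² - 1` remains. -/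
lemma integral_rodrigues_mul {k i : ℕ} (hi : i ≤ k) (q : ℝ[X]) (hq : derivative^[i] q = 0) :
    ∫ t in (-1 : ℝ)..1, (rodrigues k i).eval t * q.eval t = 0 := by
  induction i generalizing q with
  | zero =>
    have : q = 0 := hq
    simp [this]
  | succ i ih =>
    rw [← derivative_rodrigues, integral_derivative_mul,
      eval_rodrigues_eq_zero hi (by norm_num), eval_rodrigues_eq_zero hi (by norm_num),
      ih (by omega) _ hq]
    simp

lemma integral_legendre_mul {k : ℕ} (q : ℝ[X]) (hq : derivative^[k] q = 0) :
    ∫ t in (-1 : ℝ)..1, (legendre k).eval t * q.eval t = 0 := by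
  have e := iterate_derivative_legendre 0 k
  simp only [Function.iterate_zero, id, add_zero] at e
  simp only [e, eval_mul, eval_C, mul_assoc, intervalIntegral.integral_const_mul,
    integral_rodrigues_mul le_rfl q hq, mul_zero]

lemma natDegree_legendre_le (k : ℕ) : (legendre k).natDegree ≤ k := by
  have h1 := natDegree_iterate_derivative ((X ^ 2 - 1 : ℝ[X]) ^ k) k
  have h2 : ((X ^ 2 - 1 : ℝ[X]) ^ k).natDegree ≤ k * 2 :=
    natDegree_pow_le_of_le k (by compute_degree)
  exact (natDegree_C_mul_le _ _).trans (by omega)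

lemma iterate_derivative_X_mul_derivative (m : ℕ) (q : ℝ[X]) :
    derivative^[m] (X * derivative q) =
      X * derivative^[m + 1] q + (m : ℝ[X]) * derivative^[m] q := by
  induction m with
  | zero => simp
  | succ m ih =>
    rw [Function.iterate_succ_apply', ih, derivative_add, derivative_mul, derivative_mul,
      derivative_X, derivative_natCast, ← Function.iterate_succ_apply' derivative (m + 1),
      ← Function.iterate_succ_apply' derivative m]
    push_cast
    ring

lemma eval_one_legendre (k : ℕ) : (legendre k).eval 1 = Real.sqrt (k + 1 / 2) := by
  simpa using eval_one_iterate_derivative_legendre 0 k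

lemma sq_eval_neg_one_legendre (k : ℕ) : (legendre k).eval (-1) ^ 2 = k + 1 / 2 := by
  have h : |(legendre k).eval (-1)| = |(legendre k).eval 1| := by
    have e := iterate_derivative_legendre 0 k
    simp only [Function.iterate_zero, id] at e
    simp only [e, eval_mul, eval_C, abs_mul, abs_eval_neg_one_rodrigues]
  rw [← sq_abs, h, sq_abs, eval_one_legendre, Real.sq_sqrt (by positivity)]

/-- The polynomial `t P' - k P` is killed by `k` derivatives, hence orthogonal to `P`, so `∫ P t P'
= k ∫ P²`. Integrating `∫ P' (t P)` by parts then gives `(2k + 1) ∫ P² = P(1)² + P(-1)² = 2k + 1`.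
-/
lemma integral_sq_legendre (k : ℕ) :
    ∫ t in (-1 : ℝ)..1, (legendre k).eval t * (legendre k).eval t = 1 := by
  set P := legendre k with hP
  have hz : derivative^[k + 1] P = 0 :=
    iterate_derivative_eq_zero (Nat.lt_succ_of_le (natDegree_legendre_le k))
  have h1 : ∫ t in (-1 : ℝ)..1, P.eval t * (X * derivative P - (k : ℝ[X]) * P).eval t = 0 := by
    refine integral_legendre_mul _ ?_
    rw [iterate_derivative_sub, iterate_derivative_X_mul_derivative, hz,
      ← C_eq_natCast, iterate_derivative_C_mul]
    ring
  have h2 := integral_derivative_mul P (X * P)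
  have i1 : IntervalIntegrable (fun t => P.eval t * (t * (derivative P).eval t)) volume (-1) 1 :=
    (by fun_prop : Continuous _).intervalIntegrable _ _
  have i2 : IntervalIntegrable (fun t => P.eval t * P.eval t) volume (-1) 1 :=
    (by fun_prop : Continuous _).intervalIntegrable _ _
  have e1 : ∫ t in (-1 : ℝ)..1, P.eval t * (t * (derivative P).eval t)
      = k * ∫ t in (-1 : ℝ)..1, P.eval t * P.eval t := by
    rw [← intervalIntegral.integral_const_mul, ← sub_eq_zero,
      ← intervalIntegral.integral_sub i1 (i2.const_mul _), ← h1]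
    congr 1
    ext t
    simp
    ring
  have e2 : ∫ t in (-1 : ℝ)..1, (derivative P).eval t * (X * P).eval t
      = ∫ t in (-1 : ℝ)..1, P.eval t * (t * (derivative P).eval t) := by
    congr 1
    ext t
    simp
    ring
  have e3 : ∫ t in (-1 : ℝ)..1, P.eval t * (derivative (X * P)).eval t
      = (∫ t in (-1 : ℝ)..1, P.eval t * P.eval t)
        + ∫ t in (-1 : ℝ)..1, P.eval t * (t * (derivative P).eval t) := by
    rw [← intervalIntegral.integral_add i2 i1]
    congr 1
    ext t
    simp
    ring
  have v1 : P.eval 1 ^ 2 = k + 1 / 2 := by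
    rw [hP, eval_one_legendre, Real.sq_sqrt (by positivity)]
  have v2 : P.eval (-1) ^ 2 = k + 1 / 2 := sq_eval_neg_one_legendre k
  rw [e2, e3, e1] at h2
  simp only [eval_mul, eval_X] at h2
  have hk : (2 * (k : ℝ) + 1) ≠ 0 := by positivity
  apply mul_left_cancel₀ hk
  linear_combination h2 + v1 + v2

lemma integral_legendre_mul_legendre (k l : ℕ) :
    ∫ t in (-1 : ℝ)..1, (legendre k).eval t * (legendre l).eval t = if k = l then 1 else 0 := by
  rcases lt_trichotomy k l with h | rfl | h
  · rw [if_neg h.ne]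
    simp_rw [mul_comm ((legendre k).eval _)]
    exact integral_legendre_mul _
      (iterate_derivative_eq_zero ((natDegree_legendre_le k).trans_lt h))
  · rw [if_pos rfl, integral_sq_legendre]
  · rw [if_neg h.ne']
    exact integral_legendre_mul _
      (iterate_derivative_eq_zero ((natDegree_legendre_le l).trans_lt h))

/-- The products `φ_k(t) φ_j(τ)` are orthonormal on `Q`. -/
lemma coeff_legendre_mul_legendre (q' q : ℕ × ℕ) :
    coeff (fun x => (legendre q'.1).eval x.1 * (legendre q'.2).eval x.2) q
      = if q' = q then 1 else 0 := by
  have hQ : Q = Set.Icc (-1 : ℝ) 1 ×ˢ Set.Icc (-1 : ℝ) 1 := (Set.Icc_prod_Icc _ _ _ _).symm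
  have e : ∀ x : ℝ × ℝ, (legendre q'.1).eval x.1 * (legendre q'.2).eval x.2 *
      ((legendre q.1).eval x.1 * (legendre q.2).eval x.2) =
      ((legendre q'.1).eval x.1 * (legendre q.1).eval x.1) *
      ((legendre q'.2).eval x.2 * (legendre q.2).eval x.2) := fun x => by ring
  have e' : ∀ k l : ℕ, ∫ t in Set.Icc (-1 : ℝ) 1, (legendre k).eval t * (legendre l).eval t
      = if k = l then 1 else 0 := fun k l => by
    rw [← integral_legendre_mul_legendre, intervalIntegral.integral_of_le (by norm_num),
      integral_Icc_eq_integral_Ioc]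
  simp only [coeff, e]
  rw [hQ, Measure.volume_eq_prod, setIntegral_prod_mul
    (fun t => (legendre q'.1).eval t * (legendre q.1).eval t)
    (fun t => (legendre q'.2).eval t * (legendre q.2).eval t), e', e']
  simp only [Prod.ext_iff]
  split_ifs <;> simp_all

end Legendre

/-! ### Counting and summation over hyperbolic crosses -/

/-- For each `k` there are at most `Y / k` values of `j`; the harmonic sum gives the logarithm. -/
lemma card_le_mul_one_add_log (Y : ℕ) (F : Finset (ℕ × ℕ))
    (hF : ∀ q ∈ F, 1 ≤ q.1 ∧ 1 ≤ q.2 ∧ q.1 * q.2 ≤ Y) :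
    (F.card : ℝ) ≤ Y * (1 + Real.log Y) := by
  have hsub : F ⊆ (Finset.Icc 1 Y).biUnion
      fun k => (Finset.Icc 1 (Y / k)).image fun j => (k, j) := by
    rintro ⟨k, j⟩ hq
    obtain ⟨h1, h2, h3⟩ := hF _ hq
    simp only [Finset.mem_biUnion, Finset.mem_image, Finset.mem_Icc]
    exact ⟨k, ⟨h1, (Nat.le_mul_of_pos_right k h2).trans h3⟩, j,
      ⟨h2, (Nat.le_div_iff_mul_le h1).2 (by rwa [mul_comm])⟩, rfl⟩
  have hcard : F.card ≤ ∑ k ∈ Finset.Icc 1 Y, Y / k := by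
    refine (Finset.card_le_card hsub).trans (Finset.card_biUnion_le.trans ?_)
    refine Finset.sum_le_sum fun k _ => Finset.card_image_le.trans (by simp)
  calc (F.card : ℝ) ≤ ((∑ k ∈ Finset.Icc 1 Y, Y / k : ℕ) : ℝ) := by exact_mod_cast hcard
    _ ≤ ∑ k ∈ Finset.Icc 1 Y, (Y : ℝ) * (k : ℝ)⁻¹ := by
        rw [Nat.cast_sum]
        exact Finset.sum_le_sum fun k _ => by rw [← div_eq_mul_inv]; exact Nat.cast_div_le
    _ = Y * ((harmonic Y : ℚ) : ℝ) := by
        rw [← Finset.mul_sum, harmonic_eq_sum_Icc]; push_cast; rfl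
    _ ≤ _ := by gcongr; exact harmonic_le_one_add_log Y

lemma sum_le_card_rpow_mul {ι : Type*} {s : ℝ} (hs : 1 ≤ s) (B : Finset ι) (a : ι → ℝ)
    (ha : ∀ i ∈ B, 0 ≤ a i) :
    ∑ i ∈ B, a i ≤ (B.card : ℝ) ^ (1 - 1 / s) * (∑ i ∈ B, a i ^ s) ^ (1 / s) := by
  have hs0 : 0 < s := by linarith
  have h := Real.rpow_sum_le_const_mul_sum_rpow B a hs
  rw [Finset.sum_congr rfl fun i hi => abs_of_nonneg (ha i hi),
    Finset.sum_congr rfl fun i hi => congrArg (· ^ s) (abs_of_nonneg (ha i hi))] at h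
  have hsum : 0 ≤ ∑ i ∈ B, a i := Finset.sum_nonneg ha
  have hsum' : 0 ≤ ∑ i ∈ B, a i ^ s :=
    Finset.sum_nonneg fun i hi => Real.rpow_nonneg (ha i hi) _
  calc ∑ i ∈ B, a i = ((∑ i ∈ B, a i) ^ s) ^ (1 / s) := by
        rw [← Real.rpow_mul hsum, mul_one_div_cancel hs0.ne', Real.rpow_one]
    _ ≤ ((B.card : ℝ) ^ (s - 1) * ∑ i ∈ B, a i ^ s) ^ (1 / s) := by
        gcongr
    _ = _ := by
        rw [Real.mul_rpow (by positivity) hsum', ← Real.rpow_mul (by positivity)]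
        congr 2
        field_simp

lemma toReal_one_div_le_one {p : ℝ≥0∞} (hp : 1 ≤ p) : (1 / p).toReal ≤ 1 := by
  refine ENNReal.toReal_le_of_le_ofReal zero_le_one ?_
  rw [ENNReal.ofReal_one, one_div]
  exact ENNReal.inv_le_one.2 hp

/-- Hölder's inequality against the indicator of `B`. For `p = ∞` the value `(1 / p).toReal` is `0`,
so the same formula covers that case. -/
lemma sum_abs_le_card_rpow_mul_norm {ι : Type*} {p : ℝ≥0∞} (hp : 1 ≤ p)
    (ξ : lp (fun _ : ι => ℝ) p) (B : Finset ι) :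
    ∑ i ∈ B, |ξ i| ≤ (B.card : ℝ) ^ (1 - (1 / p).toReal) * ‖ξ‖ := by
  have hp0 : p ≠ 0 := (zero_lt_one.trans_le hp).ne'
  rcases eq_or_ne p ∞ with rfl | htop
  · calc ∑ i ∈ B, |ξ i| ≤ ∑ _i ∈ B, ‖ξ‖ :=
          Finset.sum_le_sum fun i _ => lp.norm_apply_le_norm hp0 ξ i
      _ = _ := by simp
  · have hp1 : 1 ≤ p.toReal := by
      rw [← ENNReal.toReal_one]; exact ENNReal.toReal_mono htop hp
    have h := sum_le_card_rpow_mul hp1 B (fun i => |ξ i|) fun i _ => abs_nonneg _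
    have h' := lp.sum_rpow_le_norm_rpow (by linarith) ξ B
    have e : (1 / p).toReal = 1 / p.toReal := by simp
    rw [e]
    refine h.trans ?_
    gcongr
    calc _ ≤ (‖ξ‖ ^ p.toReal) ^ (1 / p.toReal) := by
          have : ∀ i ∈ B, (0 : ℝ) ≤ |ξ i| ^ p.toReal := fun i _ => by positivity
          exact Real.rpow_le_rpow (Finset.sum_nonneg this) h' (by positivity)
      _ = ‖ξ‖ := by
          rw [← Real.rpow_mul (lp.norm_nonneg' ξ), mul_one_div_cancel (by linarith), Real.rpow_one]

/-- Raising the logarithm to the first power is wasteful but harmless: the upper rate carries `ln^{2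
- 1/s}`, whose exponent is at least `1`. -/
lemma rpow_mul_one_add_log_le {y t : ℝ} (hy : 1 ≤ y) (ht1 : t ≤ 1) :
    (y * (1 + Real.log y)) ^ t ≤ y ^ t * (1 + Real.log y) := by
  have hl : 1 ≤ 1 + Real.log y := by linarith [Real.log_nonneg hy]
  rw [Real.mul_rpow (by linarith) (by linarith)]
  gcongr
  exact (Real.rpow_le_rpow_of_exponent_le hl ht1).trans_eq (Real.rpow_one _)

/-- On the block `Y/2 ≤ kj ≤ Y` the weight `(kj)^ν` is at most `2^{μ-ν} Y^{-(μ-ν)} (kj)^μ`. Hölder's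
inequality with exponent `s` and the count of the block do the rest. -/
lemma sum_dyadic_block_le {s μ ν : ℝ} (hs : 1 ≤ s) (hνμ : ν ≤ μ) {Y : ℕ} (hY : 1 ≤ Y)
    (a : ℕ × ℕ → ℝ) (ha : ∀ q, 0 ≤ a q) (B : Finset (ℕ × ℕ))
    (hB : ∑ q ∈ B, (((q.1 * q.2 : ℕ) : ℝ) ^ μ * a q) ^ s ≤ 1)
    (hB' : ∀ q ∈ B, 1 ≤ q.1 ∧ 1 ≤ q.2 ∧ q.1 * q.2 ≤ Y ∧ Y ≤ 2 * (q.1 * q.2)) :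
    ∑ q ∈ B, ((q.1 * q.2 : ℕ) : ℝ) ^ ν * a q
      ≤ 2 ^ (μ - ν) * ((Y : ℝ) ^ (-(μ - ν - 1 + 1 / s)) * (1 + Real.log Y)) := by
  have hY1 : (1 : ℝ) ≤ Y := by exact_mod_cast hY
  have hs0 : 0 < s := by linarith
  have hs1 : 1 / s ≤ 1 := by rw [div_le_one hs0]; exact hs
  have hterm : ∀ q ∈ B, ((q.1 * q.2 : ℕ) : ℝ) ^ ν * a q
      ≤ 2 ^ (μ - ν) * (Y : ℝ) ^ (-(μ - ν)) * (((q.1 * q.2 : ℕ) : ℝ) ^ μ * a q) := by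
    intro q hq
    obtain ⟨h1, h2, h3, h4⟩ := hB' q hq
    have hm : (0 : ℝ) < ((q.1 * q.2 : ℕ) : ℝ) := by exact_mod_cast Nat.mul_pos h1 h2
    have h4' : (Y : ℝ) ≤ 2 * ((q.1 * q.2 : ℕ) : ℝ) := by exact_mod_cast h4
    have hle : (Y : ℝ) ^ (μ - ν) ≤ 2 ^ (μ - ν) * ((q.1 * q.2 : ℕ) : ℝ) ^ (μ - ν) := by
      rw [← Real.mul_rpow (by norm_num) hm.le]
      exact Real.rpow_le_rpow (by linarith) h4' (by linarith)
    have e : ((q.1 * q.2 : ℕ) : ℝ) ^ μ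
        = ((q.1 * q.2 : ℕ) : ℝ) ^ (μ - ν) * ((q.1 * q.2 : ℕ) : ℝ) ^ ν := by
      rw [← Real.rpow_add hm]; ring_nf
    have hYp : 0 < (Y : ℝ) ^ (μ - ν) := by positivity
    rw [← mul_assoc]
    refine mul_le_mul_of_nonneg_right ?_ (ha q)
    rw [e, Real.rpow_neg (by linarith), ← div_eq_mul_inv, div_mul_eq_mul_div, le_div_iff₀ hYp]
    nlinarith [Real.rpow_nonneg hm.le ν]
  have hsum : ∑ q ∈ B, ((q.1 * q.2 : ℕ) : ℝ) ^ μ * a q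
      ≤ (Y : ℝ) ^ (1 - 1 / s) * (1 + Real.log Y) := by
    refine (sum_le_card_rpow_mul hs B _ fun q _ => mul_nonneg (by positivity) (ha q)).trans ?_
    have h0 : (0 : ℝ) ≤ ∑ q ∈ B, (((q.1 * q.2 : ℕ) : ℝ) ^ μ * a q) ^ s :=
      Finset.sum_nonneg fun q _ =>
        Real.rpow_nonneg (mul_nonneg (by positivity) (ha q)) _
    have hc := card_le_mul_one_add_log Y B fun q hq =>
      ⟨(hB' q hq).1, (hB' q hq).2.1, (hB' q hq).2.2.1⟩
    calc _ ≤ (B.card : ℝ) ^ (1 - 1 / s) * 1 := by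
          gcongr
          exact Real.rpow_le_one h0 hB (by positivity)
      _ ≤ ((Y : ℝ) * (1 + Real.log Y)) ^ (1 - 1 / s) := by
          rw [mul_one]
          exact Real.rpow_le_rpow (by positivity) hc (by linarith)
      _ ≤ _ := rpow_mul_one_add_log_le hY1 (by
          have : 0 ≤ 1 / s := by positivity
          linarith)
  calc _ ≤ ∑ q ∈ B, 2 ^ (μ - ν) * (Y : ℝ) ^ (-(μ - ν)) * (((q.1 * q.2 : ℕ) : ℝ) ^ μ * a q) :=
        Finset.sum_le_sum hterm
    _ ≤ 2 ^ (μ - ν) * (Y : ℝ) ^ (-(μ - ν)) * ((Y : ℝ) ^ (1 - 1 / s) * (1 + Real.log Y)) := by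
        rw [← Finset.mul_sum]; gcongr
    _ = _ := by
        rw [show -(μ - ν - 1 + 1 / s) = -(μ - ν) + (1 - 1 / s) by ring,
          Real.rpow_add (by linarith)]
        ring

/-- The tail of a weighted sum outside the hyperbolic cross of order `X`. -/
lemma exists_sum_tail_le {s μ ν : ℝ} (hs : 1 ≤ s) (hα : 0 < μ - ν - 1 + 1 / s) :
    ∃ C : ℝ, 0 < C ∧ ∀ (X : ℕ) (a : ℕ × ℕ → ℝ) (F : Finset (ℕ × ℕ)), 1 ≤ X → (∀ q, 0 ≤ a q) →
      ∑ q ∈ F, (((q.1 * q.2 : ℕ) : ℝ) ^ μ * a q) ^ s ≤ 1 →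
      (∀ q ∈ F, 1 ≤ q.1 ∧ 1 ≤ q.2 ∧ X ≤ q.1 * q.2) →
      ∑ q ∈ F, ((q.1 * q.2 : ℕ) : ℝ) ^ ν * a q
        ≤ C * ((X : ℝ) ^ (-(μ - ν - 1 + 1 / s)) * (1 + Real.log X)) := by
  set α := μ - ν - 1 + 1 / s with hαdef
  have hs1 : 1 / s ≤ 1 := by rw [div_le_one (by linarith)]; exact hs
  set ρ : ℝ := 2 ^ (-α) with hρ
  have hρ0 : 0 < ρ := by positivity
  have hρ1 : ρ < 1 := Real.rpow_lt_one_of_one_lt_of_neg (by norm_num) (by linarith)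
  -- The block `i` has `Y = 2^{i+1} X`: the power of `Y` contributes the geometric factor `ρ^{i+1}`,
  -- and `1 + ln Y` grows only linearly in `i`.
  have hsm : Summable fun i : ℕ => ((i : ℝ) + 2) * ρ ^ (i + 1) := by
    have h1 := summable_pow_mul_geometric_of_norm_lt_one 1 (r := ρ)
      (by rwa [Real.norm_of_nonneg hρ0.le])
    have h2 := summable_geometric_of_lt_one hρ0.le hρ1
    refine ((h1.mul_right ρ).add (h2.mul_left (2 * ρ))).congr fun i => ?_
    ring
  have hnn : ∀ i : ℕ, 0 ≤ ((i : ℝ) + 2) * ρ ^ (i + 1) := fun i => by positivity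
  refine ⟨2 ^ (μ - ν) * ∑' i : ℕ, ((i : ℝ) + 2) * ρ ^ (i + 1),
    mul_pos (by positivity) (hsm.tsum_pos hnn 0 (by positivity)), ?_⟩
  intro X a F hX ha hF hF'
  have hX1 : (1 : ℝ) ≤ X := by exact_mod_cast hX
  have hlX := Real.log_nonneg hX1
  set g : ℕ × ℕ → ℕ := fun q => Nat.log 2 (q.1 * q.2 / X) with hg
  have hblock : ∀ i ∈ F.image g, ∑ q ∈ F with g q = i, ((q.1 * q.2 : ℕ) : ℝ) ^ ν * a q
      ≤ 2 ^ (μ - ν) * ((X : ℝ) ^ (-α) * (1 + Real.log X)) * (((i : ℝ) + 2) * ρ ^ (i + 1)) := by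
    intro i _
    have hY : 1 ≤ 2 ^ (i + 1) * X := Nat.mul_pos (by positivity) hX
    have h := sum_dyadic_block_le (ν := ν) hs (by linarith) hY a ha {q ∈ F | g q = i}
      ((Finset.sum_le_sum_of_subset_of_nonneg (Finset.filter_subset _ _) fun q _ _ =>
        Real.rpow_nonneg (mul_nonneg (by positivity) (ha q)) _).trans hF) ?_
    · refine h.trans ?_
      push_cast
      rw [← hαdef, mul_assoc (2 ^ (μ - ν) : ℝ)]
      refine mul_le_mul_of_nonneg_left ?_ (by positivity)
      have e : ((2 : ℝ) ^ (i + 1) * X) ^ (-α) = ρ ^ (i + 1) * (X : ℝ) ^ (-α) := by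
        rw [Real.mul_rpow (by positivity) (by positivity), hρ, ← Real.rpow_natCast,
          ← Real.rpow_natCast, ← Real.rpow_mul (by norm_num), ← Real.rpow_mul (by norm_num),
          mul_comm (-α)]
      have hl : 1 + Real.log ((2 : ℝ) ^ (i + 1) * X) ≤ (1 + Real.log X) * ((i : ℝ) + 2) := by
        rw [Real.log_mul (by positivity) (by positivity), Real.log_pow]
        have := Real.log_two_lt_d9
        push_cast
        have h2 : Real.log 2 ≤ 1 := by linarith
        have hi : (0 : ℝ) ≤ i := by positivity
        nlinarith [mul_nonneg hi (sub_nonneg.2 h2), mul_nonneg hi hlX]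
      rw [e]
      calc _ ≤ ρ ^ (i + 1) * (X : ℝ) ^ (-α) * ((1 + Real.log X) * ((i : ℝ) + 2)) := by gcongr
        _ = _ := by ring
    · intro q hq
      obtain ⟨hqF, hqi⟩ := Finset.mem_filter.1 hq
      obtain ⟨h1, h2, h3⟩ := hF' q hqF
      have hne : q.1 * q.2 / X ≠ 0 := (Nat.div_pos h3 hX).ne'
      have hlo := Nat.pow_log_le_self 2 hne
      have hhi := Nat.lt_pow_succ_log_self (b := 2) (by norm_num) (q.1 * q.2 / X)
      change Nat.log 2 (q.1 * q.2 / X) = i at hqi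
      rw [hqi] at hlo hhi
      refine ⟨h1, h2, ((Nat.div_lt_iff_lt_mul hX).1 hhi).le, ?_⟩
      have := (Nat.le_div_iff_mul_le hX).1 hlo
      rw [pow_succ]
      linarith
  rw [← Finset.sum_fiberwise_of_maps_to (g := g) (t := F.image g)
    fun q hq => Finset.mem_image_of_mem g hq]
  calc _ ≤ ∑ i ∈ F.image g,
        2 ^ (μ - ν) * ((X : ℝ) ^ (-α) * (1 + Real.log X)) * (((i : ℝ) + 2) * ρ ^ (i + 1)) :=
        Finset.sum_le_sum hblock
    _ ≤ 2 ^ (μ - ν) * ((X : ℝ) ^ (-α) * (1 + Real.log X)) *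
        ∑' i : ℕ, ((i : ℝ) + 2) * ρ ^ (i + 1) := by
        rw [← Finset.mul_sum]
        gcongr
        exact hsm.sum_le_tsum _ fun i _ => hnn i
    _ = _ := by ring

/-! ### The truncation method -/

lemma sum_weight_coeff_le_one {s μ : ℝ} (hs : 1 ≤ s) {f : ℝ × ℝ → ℝ} (hf : f ∈ unitClass s μ)
    (G : Finset (ℕ × ℕ)) (hG : ∀ q ∈ G, 1 ≤ q.1 ∧ 1 ≤ q.2) :
    ∑ q ∈ G, (((q.1 * q.2 : ℕ) : ℝ) ^ μ * |coeff f q|) ^ s ≤ 1 := by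
  have h := hf.2
  rw [weightedNorm, ← ENNReal.one_rpow (1 / s),
    ENNReal.rpow_le_rpow_iff (by positivity)] at h
  have h' := (ENNReal.sum_le_tsum G).trans h
  rw [← ENNReal.ofReal_sum_of_nonneg fun q _ => by positivity, ENNReal.ofReal_le_one] at h'
  refine (Finset.sum_congr rfl fun q hq => ?_).trans_le h'
  have h1 : (1 : ℝ) ≤ ((q.1 * q.2 : ℕ) : ℝ) := by
    exact_mod_cast Nat.mul_pos (hG q hq).1 (hG q hq).2
  rw [max_eq_right h1, Real.mul_rpow (by positivity) (by positivity),
    ← Real.rpow_mul (by positivity), mul_comm μ]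

/-- Finite parts of the series of `f^{(r,r)}` outside the hyperbolic cross. -/
lemma exists_sum_norm_derivTerm_le {r : ℕ} (hr : 1 ≤ r) {s μ : ℝ} (hs : 1 ≤ s)
    (hμ : 2 * (r : ℝ) - 1 / s + 3 / 2 < μ) :
    ∃ C : ℝ, 0 < C ∧ ∀ (X : ℕ) (f : ℝ × ℝ → ℝ) (G : Finset (ℕ × ℕ)), 1 ≤ X → f ∈ unitClass s μ →
      (∀ q ∈ G, X ≤ (r + q.1) * (r + q.2)) →
      ∑ q ∈ G, ‖derivTerm r f q‖
        ≤ C * ((X : ℝ) ^ (-μ + 2 * r - 1 / s + 3 / 2) * (1 + Real.log X)) := by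
  obtain ⟨C, hC, h⟩ := exists_sum_tail_le (μ := μ) (ν := 2 * (r : ℝ) + 1 / 2) hs (by linarith)
  refine ⟨4 * C, by positivity, fun X f G hX hf hG => ?_⟩
  set e : ℕ × ℕ ↪ ℕ × ℕ := ⟨fun q => (r + q.1, r + q.2), fun a b hab => by
    simpa [Prod.ext_iff] using hab⟩ with he
  have hmap : ∀ q ∈ G.map e, 1 ≤ q.1 ∧ 1 ≤ q.2 ∧ X ≤ q.1 * q.2 := by
    intro q hq
    obtain ⟨q', hq', rfl⟩ := Finset.mem_map.1 hq
    exact ⟨hr.trans (Nat.le_add_right _ _), hr.trans (Nat.le_add_right _ _), hG q' hq'⟩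
  have h1 := h X (fun q => |coeff f q|) (G.map e) hX (fun q => abs_nonneg _)
    (sum_weight_coeff_le_one hs hf _ fun q hq => ⟨(hmap q hq).1, (hmap q hq).2.1⟩) hmap
  rw [Finset.sum_map] at h1
  have h2 : ∀ q ∈ G, ‖derivTerm r f q‖ ≤ 4 *
      ((((e q).1 * (e q).2 : ℕ) : ℝ) ^ (2 * (r : ℝ) + 1 / 2) * |coeff f (e q)|) := by
    intro q _
    rw [derivTerm, norm_smul, Real.norm_eq_abs]
    have := norm_basisDeriv_le hr (q := (r + q.1, r + q.2)) (Nat.le_add_right _ _)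
      (Nat.le_add_right _ _)
    calc _ ≤ |coeff f (r + q.1, r + q.2)| *
          (4 * (((r + q.1) * (r + q.2) : ℕ) : ℝ) ^ (2 * (r : ℝ) + 1 / 2)) := by gcongr
      _ = 4 * ((((r + q.1) * (r + q.2) : ℕ) : ℝ) ^ (2 * (r : ℝ) + 1 / 2) *
          |coeff f (r + q.1, r + q.2)|) := by ring
  refine (Finset.sum_le_sum h2).trans ?_
  rw [← Finset.mul_sum, mul_assoc]
  refine mul_le_mul_of_nonneg_left (h1.trans_eq ?_) (by norm_num)
  ring_nf

lemma summable_derivTerm {r : ℕ} (hr : 1 ≤ r) {s μ : ℝ} (hs : 1 ≤ s)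
    (hμ : 2 * (r : ℝ) - 1 / s + 3 / 2 < μ) {f : ℝ × ℝ → ℝ} (hf : f ∈ unitClass s μ) :
    Summable (derivTerm r f) := by
  obtain ⟨C, _, h⟩ := exists_sum_norm_derivTerm_le hr hs hμ
  refine Summable.of_norm (summable_of_sum_le (fun q => norm_nonneg _) fun G =>
    h 1 f G le_rfl hf fun q _ => ?_)
  exact Nat.mul_pos (by omega) (by omega)

/-- The constraints `k, j < n` are redundant: `j ≥ r` and `kj < rn` force `k < n`. Hence the indices
`k, j ≥ r` missing from the cross are exactly those with `kj ≥ rn`. -/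
lemma mem_hyperbolicCross {r n : ℕ} {q : ℕ × ℕ} :
    q ∈ hyperbolicCross r n ↔ r ≤ q.1 ∧ r ≤ q.2 ∧ q.1 * q.2 < r * n := by
  simp only [hyperbolicCross, Finset.mem_filter, Finset.mem_product, Finset.mem_Ico]
  constructor
  · rintro ⟨⟨⟨h1, _⟩, h2, _⟩, h3⟩
    exact ⟨h1, h2, h3⟩
  · rintro ⟨h1, h2, h3⟩
    refine ⟨⟨⟨h1, ?_⟩, h2, ?_⟩, h3⟩
    · exact lt_of_mul_lt_mul_left (((Nat.mul_comm r q.1).trans_le (Nat.mul_le_mul_left _ h2)).trans_lt h3)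
        (Nat.zero_le r)
    · exact lt_of_mul_lt_mul_left ((Nat.mul_le_mul_right _ h1).trans_lt h3) (Nat.zero_le r)

lemma card_hyperbolicCross_le {r n : ℕ} (hr : 1 ≤ r) :
    ((hyperbolicCross r n).card : ℝ) ≤ (r * n : ℕ) * (1 + Real.log (r * n : ℕ)) :=
  card_le_mul_one_add_log _ _ fun _ hq =>
    have h := mem_hyperbolicCross.1 hq
    ⟨hr.trans h.1, hr.trans h.2.1, h.2.2.le⟩

lemma norm_tsum_sub_sum_le {ι E : Type*} [NormedAddCommGroup E] {u : ι → E} (hu : Summable u)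
    (T : Finset ι) {B : ℝ} (hB : ∀ G : Finset ι, Disjoint G T → ∑ i ∈ G, ‖u i‖ ≤ B) :
    ‖∑' i, u i - ∑ i ∈ T, u i‖ ≤ B := by
  classical
  refine le_of_tendsto (hu.hasSum.sub_const (∑ i ∈ T, u i)).norm
    (Filter.eventually_atTop.2 ⟨T, fun G hG => ?_⟩)
  rw [← Finset.sum_sdiff hG, add_sub_cancel_right]
  exact (norm_sum_le _ _).trans (hB _ Finset.sdiff_disjoint)

/-- The error of the truncation method. -/
lemma exists_algError_truncation_le {r : ℕ} (hr : 1 ≤ r) {s μ : ℝ} (hs : 1 ≤ s)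
    (hμ : 2 * (r : ℝ) - 1 / s + 3 / 2 < μ) {p : ℝ≥0∞} (hp : 1 ≤ p) :
    ∃ C : ℝ, 0 < C ∧ ∀ (δ : ℝ) (n : ℕ), 0 < δ → 1 ≤ n →
      algError r s μ p δ (hyperbolicCross r n) (truncation r n) ≤ ENNReal.ofReal (C *
        (((r * n : ℕ) : ℝ) ^ (-μ + 2 * r - 1 / s + 3 / 2) * (1 + Real.log (r * n : ℕ)) +
        δ * ((r * n : ℕ) : ℝ) ^ (2 * (r : ℝ) + 1 / 2) *
          ((r * n : ℕ) * (1 + Real.log (r * n : ℕ))) ^ (1 - (1 / p).toReal))) := by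
  obtain ⟨C, hC, h⟩ := exists_sum_norm_derivTerm_le hr hs hμ
  have hu := toReal_one_div_le_one hp
  refine ⟨C + 4, by positivity, fun δ n hδ hn => ?_⟩
  have hX : 1 ≤ r * n := Nat.mul_pos hr hn
  set X : ℕ := r * n with hXdef
  have hX1 : (1 : ℝ) ≤ X := by exact_mod_cast hX
  have hlX := Real.log_nonneg hX1
  refine iSup₂_le fun f hf => iSup₂_le fun y hy => ?_
  obtain ⟨ξ, hξ, hξδ⟩ := hy
  rw [← ofReal_norm]
  refine ENNReal.ofReal_le_ofReal ?_
  -- The cross in the shifted indexing of `derivTerm`, where `(0, 0)` stands for `(r, r)`.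
  set T : Finset (ℕ × ℕ) := (hyperbolicCross r n).image fun q => (q.1 - r, q.2 - r) with hT
  have hsumT : ∑ q ∈ T, derivTerm r f q
      = ∑ q ∈ hyperbolicCross r n, coeff f q • basisDeriv r q := by
    rw [hT, Finset.sum_image]
    · refine Finset.sum_congr rfl fun q hq => ?_
      have := mem_hyperbolicCross.1 hq
      rw [derivTerm]
      simp only [Nat.add_sub_cancel' this.1, Nat.add_sub_cancel' this.2.1]
    · intro q hq q' hq' hqq
      have h1 := mem_hyperbolicCross.1 hq
      have h2 := mem_hyperbolicCross.1 hq'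
      simp only [Prod.ext_iff] at hqq ⊢
      omega
  have htrunc : truncation r n (fun q => y q)
      = ∑ q ∈ hyperbolicCross r n, y q • basisDeriv r q :=
    Finset.sum_coe_sort (hyperbolicCross r n) fun q => y q • basisDeriv r q
  have htail : ‖mixedDeriv r f - ∑ q ∈ T, derivTerm r f q‖
      ≤ C * ((X : ℝ) ^ (-μ + 2 * r - 1 / s + 3 / 2) * (1 + Real.log X)) := by
    refine norm_tsum_sub_sum_le (summable_derivTerm hr hs hμ hf) T fun G hG => ?_
    refine h X f G hX hf fun q hq => ?_
    by_contra hlt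
    refine Finset.disjoint_left.1 hG hq (Finset.mem_image.2 ⟨(r + q.1, r + q.2), ?_, by simp⟩)
    exact mem_hyperbolicCross.2 ⟨Nat.le_add_right _ _, Nat.le_add_right _ _, not_le.1 hlt⟩
  have hnoise : ‖∑ q ∈ T, derivTerm r f q - truncation r n (fun q => y q)‖
      ≤ 4 * (δ * (X : ℝ) ^ (2 * (r : ℝ) + 1 / 2) *
        (X * (1 + Real.log X)) ^ (1 - (1 / p).toReal)) := by
    rw [hsumT, htrunc, ← Finset.sum_sub_distrib]
    calc _ ≤ ∑ q ∈ hyperbolicCross r n, 4 * (X : ℝ) ^ (2 * (r : ℝ) + 1 / 2) * |ξ q| := by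
          refine norm_sum_le_of_le _ fun q hq => ?_
          obtain ⟨h1, h2, h3⟩ := mem_hyperbolicCross.1 hq
          have h3' : ((q.1 * q.2 : ℕ) : ℝ) ≤ X := by exact_mod_cast h3.le
          rw [← sub_smul, ← hξ, norm_smul, Real.norm_eq_abs, mul_comm]
          refine mul_le_mul_of_nonneg_right ((norm_basisDeriv_le hr h1 h2).trans ?_)
            (abs_nonneg _)
          gcongr
      _ ≤ 4 * (X : ℝ) ^ (2 * (r : ℝ) + 1 / 2) *
          (((hyperbolicCross r n).card : ℝ) ^ (1 - (1 / p).toReal) * ‖ξ‖) := by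
          rw [← Finset.mul_sum]
          gcongr
          exact sum_abs_le_card_rpow_mul_norm hp ξ _
      _ ≤ 4 * (X : ℝ) ^ (2 * (r : ℝ) + 1 / 2) *
          ((X * (1 + Real.log X)) ^ (1 - (1 / p).toReal) * δ) := by
          have hu' : 0 ≤ 1 - (1 / p).toReal := by linarith
          have := lp.norm_nonneg' ξ
          gcongr
          exact card_hyperbolicCross_le hr
      _ = _ := by ring
  have hA : 0 ≤ (X : ℝ) ^ (-μ + 2 * r - 1 / s + 3 / 2) * (1 + Real.log X) := by positivity
  have hB : 0 ≤ δ * (X : ℝ) ^ (2 * (r : ℝ) + 1 / 2) *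
      (X * (1 + Real.log X)) ^ (1 - (1 / p).toReal) := by positivity
  have hsplit := norm_sub_le_norm_sub_add_norm_sub (mixedDeriv r f)
    (∑ q ∈ T, derivTerm r f q) (truncation r n fun q => y q)
  nlinarith [mul_nonneg hC.le hB]

/-! ### The lower bound for the minimal radius -/

lemma coeff_neg (f : ℝ × ℝ → ℝ) (q : ℕ × ℕ) : coeff (-f) q = -coeff f q := by
  simp only [coeff, Pi.neg_apply, neg_mul, integral_neg]

lemma mixedDeriv_neg (r : ℕ) (f : ℝ × ℝ → ℝ) : mixedDeriv r (-f) = -mixedDeriv r f := by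
  simp only [mixedDeriv, derivTerm, coeff_neg, neg_smul, tsum_neg]

lemma neg_mem_unitClass {s μ : ℝ} {f : ℝ × ℝ → ℝ} (hf : f ∈ unitClass s μ) :
    -f ∈ unitClass s μ := by
  refine ⟨hf.1.neg, ?_⟩
  have := hf.2
  simpa only [weightedNorm, coeff_neg, abs_neg] using this

lemma isPerturbation_coeff (p : ℝ≥0∞) {δ : ℝ} (hδ : 0 ≤ δ) (f : ℝ × ℝ → ℝ) :
    IsPerturbation p δ f (coeff f) :=
  ⟨0, fun q => by simp, by rwa [lp.norm_zero]⟩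

/-- An algorithm cannot tell `f` from `-f` when it uses only vanishing coefficients. -/
lemma enorm_mixedDeriv_le_algError {r : ℕ} {s μ : ℝ} {p : ℝ≥0∞} {δ : ℝ} (hδ : 0 ≤ δ)
    {Ω : Finset (ℕ × ℕ)} (ψ : (Ω → ℝ) → C(Q, ℝ)) {f : ℝ × ℝ → ℝ} (hf : f ∈ unitClass s μ)
    (hΩ : ∀ q ∈ Ω, coeff f q = 0) : ‖mixedDeriv r f‖ₑ ≤ algError r s μ p δ Ω ψ := by
  have key : ∀ g ∈ unitClass s μ, (∀ q ∈ Ω, coeff g q = 0) →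
      ‖mixedDeriv r g - ψ 0‖ₑ ≤ algError r s μ p δ Ω ψ := by
    intro g hg h0
    have e : (fun q : Ω => coeff g q) = 0 := funext fun q => h0 q q.2
    rw [← e]
    exact le_iSup₂_of_le g hg (le_iSup₂_of_le (coeff g) (isPerturbation_coeff p hδ g) le_rfl)
  have h1 := key f hf hΩ
  have h2 := key (-f) (neg_mem_unitClass hf) fun q hq => by rw [coeff_neg, hΩ q hq, neg_zero]
  rw [mixedDeriv_neg] at h2
  set A := mixedDeriv r f
  -- Both `f` and `-f` with exact data yield the output `ψ 0`, so the larger of the two errors is at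
  -- least `‖A‖`.
  have h3 : 2 * ‖A‖ ≤ ‖A - ψ 0‖ + ‖-A - ψ 0‖ := by
    calc 2 * ‖A‖ = ‖(2 : ℝ) • A‖ := by rw [norm_smul]; simp
      _ = ‖(A - ψ 0) - (-A - ψ 0)‖ := by congr 1; rw [two_smul]; abel
      _ ≤ _ := norm_sub_le _ _
  rcases le_total ‖A - ψ 0‖ ‖-A - ψ 0‖ with h | h
  · refine le_trans ?_ h2
    rw [← ofReal_norm, ← ofReal_norm]
    exact ENNReal.ofReal_le_ofReal (by linarith)
  · refine le_trans ?_ h1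
    rw [← ofReal_norm, ← ofReal_norm]
    exact ENNReal.ofReal_le_ofReal (by linarith)

/-- The function `a φ_r(t) ∑_{i ∈ J} φ_{r+i}(τ)`. -/
noncomputable def rowSum (r : ℕ) (a : ℝ) (J : Finset ℕ) (x : ℝ × ℝ) : ℝ :=
  ∑ i ∈ J, a * ((legendre r).eval x.1 * (legendre (r + i)).eval x.2)

lemma continuous_rowSum (r : ℕ) (a : ℝ) (J : Finset ℕ) : Continuous (rowSum r a J) := by
  unfold rowSum
  fun_prop

lemma coeff_rowSum (r : ℕ) (a : ℝ) (J : Finset ℕ) (q : ℕ × ℕ) :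
    coeff (rowSum r a J) q = ∑ i ∈ J, if (r, r + i) = q then a else 0 := by
  have e : coeff (rowSum r a J) q = ∑ i ∈ J, a *
      coeff (fun x => (legendre (r, r + i).1).eval x.1 * (legendre (r, r + i).2).eval x.2) q := by
    simp only [coeff, rowSum, Finset.sum_mul, mul_assoc, ← integral_const_mul]
    refine integral_finsetSum _ fun i _ => ?_
    exact Continuous.integrableOn_Icc (by fun_prop)
  rw [e]
  refine Finset.sum_congr rfl fun i _ => ?_
  rw [coeff_legendre_mul_legendre (r, r + i) q, mul_ite, mul_one, mul_zero]

lemma coeff_rowSum_of_mem {r : ℕ} (a : ℝ) {J : Finset ℕ} {i : ℕ} (hi : i ∈ J) :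
    coeff (rowSum r a J) (r, r + i) = a := by
  rw [coeff_rowSum, Finset.sum_eq_single i]
  · simp
  · intro j _ hj
    simp [hj]
  · exact fun h => absurd hi h

lemma coeff_rowSum_eq_zero {r : ℕ} (a : ℝ) {J : Finset ℕ} {q : ℕ × ℕ}
    (hq : ∀ i ∈ J, (r, r + i) ≠ q) : coeff (rowSum r a J) q = 0 := by
  rw [coeff_rowSum]
  exact Finset.sum_eq_zero fun i hi => if_neg (hq i hi)

lemma memLp_rowSum (r : ℕ) (a : ℝ) (J : Finset ℕ) :
    MemLp (rowSum r a J) 2 (volume.restrict Q) := by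
  obtain ⟨C, hC⟩ := isCompact_Icc.exists_bound_of_continuousOn
    (continuous_rowSum r a J).continuousOn (s := Q)
  have : IsFiniteMeasure (volume.restrict Q) :=
    ⟨by rw [Measure.restrict_apply_univ]; exact isCompact_Icc.measure_lt_top⟩
  exact MemLp.of_bound (continuous_rowSum r a J).aestronglyMeasurable C
    (ae_restrict_of_forall_mem measurableSet_Icc hC)

/-- At most `N` coefficients are nonzero, and `haM` makes each contribute at most `1 / N` to the sum
of `s`-th powers. -/
lemma rowSum_mem_unitClass {r : ℕ} (hr : 1 ≤ r) {s μ a : ℝ} (hs : 1 ≤ s) (hμ : 0 ≤ μ) (ha : 0 ≤ a)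
    {J : Finset ℕ} {M N : ℕ} (hN : 1 ≤ N) (hJ : J.card ≤ N) (hM : ∀ i ∈ J, r * (r + i) ≤ M)
    (haM : (M : ℝ) ^ μ * a ≤ (N : ℝ) ^ (-(1 / s))) :
    rowSum r a J ∈ unitClass s μ := by
  refine ⟨memLp_rowSum r a J, ?_⟩
  have hN0 : (0 : ℝ) < N := by exact_mod_cast hN
  rw [weightedNorm]
  refine ENNReal.rpow_le_one ?_ (by positivity)
  rw [tsum_eq_sum (s := J.image fun i => (r, r + i))]
  · calc _ ≤ ∑ _q ∈ J.image fun i => (r, r + i), ENNReal.ofReal (1 / N) := by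
          refine Finset.sum_le_sum fun q hq => ENNReal.ofReal_le_ofReal ?_
          obtain ⟨i, hi, rfl⟩ := Finset.mem_image.1 hq
          rw [coeff_rowSum_of_mem a hi, abs_of_nonneg ha]
          have h1 : (1 : ℝ) ≤ ((r * (r + i) : ℕ) : ℝ) := by
            exact_mod_cast Nat.mul_pos hr (by omega)
          have h2 : ((r * (r + i) : ℕ) : ℝ) ≤ M := by exact_mod_cast hM i hi
          rw [max_eq_right h1, mul_comm s, Real.rpow_mul (by positivity),
            ← Real.mul_rpow (by positivity) ha]
          calc _ ≤ ((N : ℝ) ^ (-(1 / s))) ^ s := by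
                refine Real.rpow_le_rpow (by positivity) (le_trans ?_ haM) (by linarith)
                gcongr
            _ = 1 / N := by
                rw [← Real.rpow_mul hN0.le, neg_mul, one_div_mul_cancel (by linarith),
                  Real.rpow_neg_one, one_div]
      _ ≤ N * ENNReal.ofReal (1 / N) := by
          rw [Finset.sum_const, nsmul_eq_mul]
          gcongr
          exact Finset.card_image_le.trans hJ
      _ = 1 := by
          rw [← ENNReal.ofReal_natCast, ← ENNReal.ofReal_mul hN0.le, mul_one_div_cancel hN0.ne',
            ENNReal.ofReal_one]
  · intro q hq
    rw [coeff_rowSum_eq_zero a fun i hi h => hq (Finset.mem_image.2 ⟨i, hi, h⟩), abs_zero,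
      Real.zero_rpow (by linarith), mul_zero, ENNReal.ofReal_zero]

lemma mixedDeriv_rowSum (r : ℕ) (a : ℝ) (J : Finset ℕ) :
    mixedDeriv r (rowSum r a J) = ∑ i ∈ J, a • basisDeriv r (r, r + i) := by
  rw [mixedDeriv, tsum_eq_sum (s := J.image fun i => (0, i)),
    Finset.sum_image fun i _ j _ h => (Prod.ext_iff.1 h).2]
  · refine Finset.sum_congr rfl fun i hi => ?_
    rw [derivTerm, add_zero, coeff_rowSum_of_mem a hi]
  · intro q hq
    rw [derivTerm, coeff_rowSum_eq_zero a, zero_smul]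
    intro i hi h
    refine hq (Finset.mem_image.2 ⟨i, hi, ?_⟩)
    simp only [Prod.ext_iff] at h ⊢
    omega

/-- Evaluation at the corner `(1, 1)`, where all derivatives are positive and no cancellation
occurs. -/
lemma le_norm_mixedDeriv_rowSum {r : ℕ} (hr : 1 ≤ r) {a : ℝ} (ha : 0 ≤ a) {J : Finset ℕ} {N : ℕ}
    (hcard : N ≤ J.card) (hJ : ∀ i ∈ J, N ≤ i) :
    N * (a * (((1 / (2 * (r : ℝ) ^ 2)) ^ r) ^ 2 * (N : ℝ) ^ (2 * (r : ℝ) + 1 / 2)))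
      ≤ ‖mixedDeriv r (rowSum r a J)‖ := by
  set c : ℝ := (1 / (2 * (r : ℝ) ^ 2)) ^ r with hc
  set ν : ℝ := 2 * (r : ℝ) + 1 / 2 with hν
  have hr1 : (1 : ℝ) ≤ r := by exact_mod_cast hr
  have hc0 : 0 ≤ c := by positivity
  let z : Q := ⟨(1, 1), ⟨⟨by norm_num, by norm_num⟩, le_rfl⟩⟩
  refine le_trans ?_ ((mixedDeriv r (rowSum r a J)).norm_coe_le_norm z)
  refine le_trans ?_ (Real.le_norm_self _)
  rw [mixedDeriv_rowSum, ContinuousMap.sum_apply]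
  calc _ ≤ (J.card : ℝ) * (a * (c ^ 2 * (N : ℝ) ^ ν)) := by gcongr
    _ = ∑ i ∈ J, a * (c ^ 2 * (N : ℝ) ^ ν) := by rw [Finset.sum_const, nsmul_eq_mul]
    _ ≤ _ := by
        refine Finset.sum_le_sum fun i hi => ?_
        have e : (a • basisDeriv r (r, r + i)) z = a *
            ((Polynomial.derivative^[r] (legendre r)).eval 1 *
              (Polynomial.derivative^[r] (legendre (r + i))).eval 1) := rfl
        rw [e]
        refine mul_le_mul_of_nonneg_left ?_ ha
        have h1 := le_eval_one_iterate_derivative_legendre hr (le_refl r)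
        have h2 := le_eval_one_iterate_derivative_legendre hr (Nat.le_add_right r i)
        rw [← hc, ← hν] at h1 h2
        have h1' : c ≤ (Polynomial.derivative^[r] (legendre r)).eval 1 := by
          refine le_trans ?_ h1
          exact le_mul_of_one_le_right hc0 (Real.one_le_rpow hr1 (by positivity))
        have h2' : c * (N : ℝ) ^ ν
            ≤ (Polynomial.derivative^[r] (legendre (r + i))).eval 1 := by
          refine le_trans ?_ h2
          have : (N : ℝ) ≤ ((r + i : ℕ) : ℝ) := by exact_mod_cast (hJ i hi).trans (by omega)
          gcongr
        calc c ^ 2 * (N : ℝ) ^ ν = c * (c * (N : ℝ) ^ ν) := by ring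
          _ ≤ _ := mul_le_mul h1' h2' (by positivity) (hc0.trans h1')

lemma exists_le_minimalRadius {r : ℕ} (hr : 1 ≤ r) {s μ : ℝ} (hs : 1 ≤ s)
    (hμ : 0 ≤ μ) (p : ℝ≥0∞) :
    ∃ c : ℝ, 0 < c ∧ ∀ (δ : ℝ) (N : ℕ), 0 ≤ δ → 1 ≤ N →
      ENNReal.ofReal (c * (N : ℝ) ^ (-μ + 2 * r - 1 / s + 3 / 2)) ≤ minimalRadius r s μ p N δ := by
  have hr0 : (0 : ℝ) < r := by exact_mod_cast hr
  set c₀ : ℝ := (1 / (2 * (r : ℝ) ^ 2)) ^ r with hc₀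
  refine ⟨c₀ ^ 2 * ((2 : ℝ) ^ (-(1 / s)) * ((r : ℝ) * (r + 3)) ^ (-μ)), by positivity,
    fun δ N hδ hN => le_iInf₂ fun Ω hΩ => le_iInf fun ψ => ?_⟩
  have hN0 : (0 : ℝ) < N := by exact_mod_cast hN
  -- The interval has `2N` indices and `Ω` can remove at most `N` of them.
  set J : Finset ℕ := {i ∈ Finset.Ico N (3 * N) | (r, r + i) ∉ Ω} with hJ
  have hJle : J.card ≤ 2 * N :=
    (Finset.card_filter_le _ _).trans (by rw [Nat.card_Ico]; omega)
  have hJge : N ≤ J.card := by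
    have h1 := Finset.card_filter_add_card_filter_not (s := Finset.Ico N (3 * N))
      (fun i => (r, r + i) ∈ Ω)
    have h2 : Finset.card {i ∈ Finset.Ico N (3 * N) | (r, r + i) ∈ Ω} ≤ Ω.card := by
      refine Finset.card_le_card_of_injOn (fun i => (r, r + i))
        (fun i hi => (Finset.mem_filter.1 hi).2) fun i _ j _ h => ?_
      simpa using h
    rw [Nat.card_Ico] at h1
    change _ + J.card = _ at h1
    have := hΩ.2
    omega
  -- Chosen so that `2N` such coefficients stay in the unit ball: on the row, `r (r + i) ≤ r (r + 3)
  -- N` because `i < 3N` and `N ≥ 1`.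
  set a : ℝ := ((2 * N : ℕ) : ℝ) ^ (-(1 / s)) * ((r * ((r + 3) * N) : ℕ) : ℝ) ^ (-μ) with ha
  have hM0 : (0 : ℝ) < ((r * ((r + 3) * N) : ℕ) : ℝ) := by push_cast; positivity
  have ha0 : 0 ≤ a := by positivity
  have hmem : rowSum r a J ∈ unitClass s μ := by
    refine rowSum_mem_unitClass hr hs hμ ha0 (N := 2 * N) (M := r * ((r + 3) * N)) (by omega)
      hJle (fun i hi => Nat.mul_le_mul_left _ ?_) ?_
    · have := (Finset.mem_Ico.1 (Finset.mem_filter.1 hi).1).2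
      nlinarith
    · rw [ha, mul_left_comm, ← Real.rpow_add hM0, add_neg_cancel, Real.rpow_zero, mul_one]
  refine le_trans ?_ (enorm_mixedDeriv_le_algError hδ ψ hmem fun q hq =>
    coeff_rowSum_eq_zero a fun i hi h => (Finset.mem_filter.1 hi).2 (h ▸ hq))
  rw [← ofReal_norm]
  refine ENNReal.ofReal_le_ofReal (le_trans (le_of_eq ?_) (le_norm_mixedDeriv_rowSum hr ha0 hJge
    fun i hi => (Finset.mem_Ico.1 (Finset.mem_filter.1 hi).1).1))
  rw [ha, ← hc₀]
  push_cast
  rw [← mul_assoc (r : ℝ), Real.mul_rpow (by norm_num) hN0.le,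
    Real.mul_rpow (by positivity) hN0.le,
    show -μ + 2 * (r : ℝ) - 1 / s + 3 / 2 = 1 + -(1 / s) + -μ + (2 * (r : ℝ) + 1 / 2) by ring,
    Real.rpow_add hN0, Real.rpow_add hN0, Real.rpow_add hN0, Real.rpow_one]
  ring

/-! ### Comparison of the scales -/

lemma log_one_div_pos {δ : ℝ} (h0 : 0 < δ) (h1 : δ < 1) : 0 < Real.log (1 / δ) :=
  Real.log_pos (by rwa [lt_div_iff₀ h0, one_mul])

lemma inv_eq_exp_log_one_div {δ : ℝ} (h0 : 0 < δ) : δ⁻¹ = Real.exp (Real.log (1 / δ)) := by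
  rw [Real.exp_log (by positivity), one_div]

lemma degreeScale_pos {s μ : ℝ} {p : ℝ≥0∞} {δ : ℝ} (h0 : 0 < δ) (h1 : δ < 1) :
    0 < degreeScale s μ p δ := by
  have := log_one_div_pos h0 h1
  rw [degreeScale]
  positivity

lemma infoScale_pos {s μ : ℝ} {p : ℝ≥0∞} {δ : ℝ} (h0 : 0 < δ) (h1 : δ < 1) :
    0 < infoScale s μ p δ := by
  have := log_one_div_pos h0 h1
  rw [infoScale]
  positivity

/-- This links `N` and `n`: a cross of order `n` has `O(n ln n)` points, and `ln n` is at most of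
order `ln (1/δ)`. -/
lemma infoScale_eq {s μ : ℝ} {p : ℝ≥0∞} (hβ : 0 < μ - (1 / p).toReal + 1 / s) {δ : ℝ}
    (h0 : 0 < δ) (h1 : δ < 1) :
    infoScale s μ p δ = degreeScale s μ p δ * Real.log (1 / δ) := by
  have hL := log_one_div_pos h0 h1
  set L := Real.log (1 / δ)
  set β := μ - (1 / p).toReal + 1 / s with hβdef
  have e : δ⁻¹ * L ^ μ = δ⁻¹ * L ^ ((1 / p).toReal - 1 / s) * L ^ β := by
    rw [mul_assoc, ← Real.rpow_add hL, hβdef]; ring_nf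
  rw [infoScale, degreeScale, ← hβdef]
  change (δ⁻¹ * L ^ μ) ^ (1 / β) = _
  rw [e, Real.mul_rpow (by positivity) (by positivity), ← Real.rpow_mul hL.le,
    mul_one_div_cancel hβ.ne', Real.rpow_one]

lemma lowerRate_eq {r : ℕ} {s μ : ℝ} {p : ℝ≥0∞} {δ : ℝ} (h0 : 0 < δ) (h1 : δ < 1) :
    lowerRate r s μ p δ = infoScale s μ p δ ^ (-(μ - 2 * r + 1 / s - 3 / 2)) := by
  have hL := log_one_div_pos h0 h1
  have e : δ * Real.log (1 / δ) ^ (-μ) = (δ⁻¹ * Real.log (1 / δ) ^ μ)⁻¹ := by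
    rw [mul_inv, inv_inv, Real.rpow_neg hL.le]
  rw [lowerRate, infoScale, e, Real.inv_rpow (by positivity), ← Real.rpow_neg (by positivity),
    ← Real.rpow_mul (by positivity)]
  congr 1
  ring

lemma upperRate_eq {r : ℕ} {s μ : ℝ} {p : ℝ≥0∞} {δ : ℝ} (h0 : 0 < δ) (h1 : δ < 1) :
    upperRate r s μ p δ = degreeScale s μ p δ ^ (-(μ - 2 * r + 1 / s - 3 / 2)) *
      Real.log (1 / δ) ^ (2 - 1 / s) := by
  have hL := log_one_div_pos h0 h1
  rw [upperRate, degreeScale, ← Real.rpow_mul (by positivity), mul_neg,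
    Real.rpow_neg (by positivity), ← Real.inv_rpow (by positivity), mul_inv, inv_inv,
    ← Real.rpow_neg hL.le, neg_sub]
  congr 2
  ring

/-- The equation that balances the powers of `D` in the noise and the tail. -/
lemma mul_degreeScale_rpow {s μ : ℝ} {p : ℝ≥0∞} (hβ : 0 < μ - (1 / p).toReal + 1 / s) {δ : ℝ}
    (h0 : 0 < δ) (h1 : δ < 1) :
    δ * degreeScale s μ p δ ^ (μ - (1 / p).toReal + 1 / s)
      = Real.log (1 / δ) ^ ((1 / p).toReal - 1 / s) := by
  have hL := log_one_div_pos h0 h1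
  rw [degreeScale, ← Real.rpow_mul (by positivity), one_div_mul_cancel hβ.ne', Real.rpow_one]
  field_simp

/-- If the amount of information is bounded below then so is `ln (1/δ)`. -/
lemma exists_le_log_of_le_infoScale {s μ : ℝ} (hμ : 0 < μ) {p : ℝ≥0∞}
    (hβ : 0 < μ - (1 / p).toReal + 1 / s) {K : ℝ} (hK : 0 < K) :
    ∃ L₀ : ℝ, 0 < L₀ ∧ ∀ δ : ℝ, 0 < δ → δ < 1 → K ≤ infoScale s μ p δ →
      L₀ ≤ Real.log (1 / δ) := by
  set β := μ - (1 / p).toReal + 1 / s with hβdef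
  refine ⟨min 1 ((K ^ β / Real.exp 1) ^ (1 / μ)), by positivity, fun δ h0 h1 hle => ?_⟩
  have hL := log_one_div_pos h0 h1
  set L := Real.log (1 / δ) with hLdef
  by_contra! hlt
  have hL1 : L < 1 := hlt.trans_le (min_le_left _ _)
  have hL2 : L < (K ^ β / Real.exp 1) ^ (1 / μ) := hlt.trans_le (min_le_right _ _)
  have h2 : L ^ μ < K ^ β / Real.exp 1 := by
    have := Real.rpow_lt_rpow hL.le hL2 hμ
    rwa [← Real.rpow_mul (by positivity), one_div_mul_cancel hμ.ne', Real.rpow_one] at this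
  have h3 : K ^ β ≤ Real.exp L * L ^ μ := by
    have := Real.rpow_le_rpow hK.le hle hβ.le
    rwa [infoScale, ← hβdef, ← Real.rpow_mul (by positivity), one_div_mul_cancel hβ.ne',
      Real.rpow_one, inv_eq_exp_log_one_div h0] at this
  have h4 : Real.exp L ≤ Real.exp 1 := Real.exp_le_exp.2 hL1.le
  rw [lt_div_iff₀ (Real.exp_pos 1)] at h2
  nlinarith [Real.rpow_pos_of_pos hL μ]

/-- Needed so that rounding `n` up to an integer costs only a constant factor. The exponent `1/p -
1/s` lies in `[-1, 1]`, so `e^L` with `L = ln (1/δ)` outweighs a negative power of `L`. -/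
lemma le_degreeScale {s μ : ℝ} (hs : 1 ≤ s) {p : ℝ≥0∞} (hp : 1 ≤ p)
    (hβ : 0 < μ - (1 / p).toReal + 1 / s) {L₀ : ℝ} (hL₀ : 0 < L₀) {δ : ℝ} (h0 : 0 < δ)
    (h1 : δ < 1) (hle : L₀ ≤ Real.log (1 / δ)) :
    min 1 L₀ ^ (1 / (μ - (1 / p).toReal + 1 / s)) ≤ degreeScale s μ p δ := by
  have hL := log_one_div_pos h0 h1
  have hu := toReal_one_div_le_one hp
  have hu0 : 0 ≤ (1 / p).toReal := ENNReal.toReal_nonneg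
  have hs1 : 1 / s ≤ 1 := by rw [div_le_one (by linarith)]; exact hs
  have hs0 : 0 ≤ 1 / s := by positivity
  rw [degreeScale]
  refine Real.rpow_le_rpow (by positivity) ?_ (by positivity)
  rw [inv_eq_exp_log_one_div h0]
  set L := Real.log (1 / δ)
  have hexp := Real.add_one_le_exp L
  rcases le_total 1 L with h | h
  · have h2 : L ^ (-1 : ℝ) ≤ L ^ ((1 / p).toReal - 1 / s) :=
      Real.rpow_le_rpow_of_exponent_le h (by linarith)
    calc min 1 L₀ ≤ 1 := min_le_left _ _
      _ = L * L ^ (-1 : ℝ) := by rw [Real.rpow_neg_one, mul_inv_cancel₀ hL.ne']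
      _ ≤ _ := by gcongr; linarith
  · have h2 : L ^ (1 : ℝ) ≤ L ^ ((1 / p).toReal - 1 / s) :=
      Real.rpow_le_rpow_of_exponent_ge hL h (by linarith)
    calc min 1 L₀ ≤ L₀ := min_le_right _ _
      _ ≤ 1 * L ^ (1 : ℝ) := by rwa [one_mul, Real.rpow_one]
      _ ≤ _ := by gcongr; linarith

/-- The scale of `n` is a power of `1/δ` up to logarithms; additive constants are absorbed by means
of `L ≥ L₀`. -/
lemma exists_one_add_log_le {r : ℕ} (hr : 1 ≤ r) {s μ : ℝ} (hs : 1 ≤ s) {p : ℝ≥0∞} (hp : 1 ≤ p)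
    (hβ : 0 < μ - (1 / p).toReal + 1 / s) {L₀ : ℝ} (hL₀ : 0 < L₀) {b : ℝ} (hb : 0 < b) :
    ∃ C : ℝ, 0 < C ∧ ∀ (δ : ℝ) (n : ℕ), 0 < δ → δ < 1 → L₀ ≤ Real.log (1 / δ) → 1 ≤ n →
      n ≤ b * degreeScale s μ p δ →
      1 + Real.log ((r * n : ℕ) : ℝ) ≤ C * Real.log (1 / δ) := by
  have hu := toReal_one_div_le_one hp
  have hu0 : 0 ≤ (1 / p).toReal := ENNReal.toReal_nonneg
  have hs1 : 1 / s ≤ 1 := by rw [div_le_one (by linarith)]; exact hs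
  have hs0 : 0 ≤ 1 / s := by positivity
  have hr0 : (0 : ℝ) < r := by exact_mod_cast hr
  set β := μ - (1 / p).toReal + 1 / s with hβdef
  refine ⟨|1 + Real.log (r * b)| / L₀ + (2 + |Real.log L₀| / L₀) / β, by positivity, ?_⟩
  intro δ n h0 h1 hL hn hnb
  have hD := degreeScale_pos (s := s) (μ := μ) (p := p) h0 h1
  have hL0 := log_one_div_pos h0 h1
  have hn0 : (0 : ℝ) < n := by exact_mod_cast hn
  have hlog : Real.log ((r * n : ℕ) : ℝ)
      ≤ Real.log (r * b) + Real.log (degreeScale s μ p δ) := by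
    rw [← Real.log_mul (by positivity) hD.ne']
    push_cast
    refine Real.log_le_log (by positivity) ?_
    rw [mul_assoc]
    gcongr
  have hlogD : Real.log (degreeScale s μ p δ) = (Real.log (1 / δ) +
      ((1 / p).toReal - 1 / s) * Real.log (Real.log (1 / δ))) / β := by
    rw [degreeScale, Real.log_rpow (by positivity), Real.log_mul (by positivity) (by positivity),
      Real.log_rpow hL0, ← one_div δ]
    ring
  set L := Real.log (1 / δ)
  have hratio : 1 ≤ L / L₀ := by rwa [le_div_iff₀ hL₀, one_mul]
  have hK : ∀ x : ℝ, x ≤ |x| / L₀ * L := fun x => by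
    rw [div_mul_eq_mul_div, mul_div_assoc]
    exact (le_abs_self x).trans (le_mul_of_one_le_right (abs_nonneg x) hratio)
  have hloglog : ((1 / p).toReal - 1 / s) * Real.log L ≤ L + |Real.log L₀| / L₀ * L := by
    have h2 : |Real.log L| ≤ L + |Real.log L₀| / L₀ * L := by
      have h3 : 0 ≤ |Real.log L₀| / L₀ * L := by positivity
      rw [abs_le]
      constructor
      · have := hK (-Real.log L₀)
        rw [abs_neg] at this
        have := Real.log_le_log hL₀ hL
        linarith
      · linarith [Real.log_le_sub_one_of_pos hL0]
    refine le_trans (le_abs_self _) (le_trans ?_ h2)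
    rw [abs_mul]
    exact mul_le_of_le_one_left (abs_nonneg _) (abs_le.2 ⟨by linarith, by linarith⟩)
  calc 1 + Real.log ((r * n : ℕ) : ℝ)
      ≤ (1 + Real.log (r * b)) + Real.log (degreeScale s μ p δ) := by linarith
    _ ≤ |1 + Real.log (r * b)| / L₀ * L + (2 * L + |Real.log L₀| / L₀ * L) / β := by
        rw [hlogD]
        refine add_le_add (hK _) (div_le_div_of_nonneg_right ?_ hβ.le)
        linarith
    _ = _ := by ring

lemma exists_log_one_div_le {s μ : ℝ} (hμ : 0 < μ) {p : ℝ≥0∞}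
    (hβ : 0 < μ - (1 / p).toReal + 1 / s) {L₀ : ℝ} (hL₀ : 0 < L₀) {c₁ : ℝ} (hc₁ : 0 < c₁) :
    ∃ C : ℝ, 0 < C ∧ ∀ (δ : ℝ) (N : ℕ), 0 < δ → δ < 1 → L₀ ≤ Real.log (1 / δ) → 2 ≤ N →
      c₁ * infoScale s μ p δ ≤ N → Real.log (1 / δ) ≤ C * Real.log N := by
  have hl2 : 0 < Real.log 2 := Real.log_pos one_lt_two
  set β := μ - (1 / p).toReal + 1 / s with hβdef
  refine ⟨β + |β * Real.log c₁ + μ * Real.log L₀| / Real.log 2, by positivity, ?_⟩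
  intro δ N h0 h1 hL hN hle
  have hL0 := log_one_div_pos h0 h1
  have hI := infoScale_pos (s := s) (μ := μ) (p := p) h0 h1
  have hlogN : Real.log 2 ≤ Real.log N := Real.log_le_log two_pos (by exact_mod_cast hN)
  have h2 := Real.log_le_log (by positivity) hle
  rw [Real.log_mul hc₁.ne' hI.ne', infoScale, Real.log_rpow (by positivity),
    Real.log_mul (by positivity) (by positivity), Real.log_rpow hL0, ← one_div δ, ← hβdef] at h2
  set L := Real.log (1 / δ)
  have h3 := Real.log_le_log hL₀ hL
  have h4 : β * Real.log c₁ + (L + μ * Real.log L) ≤ β * Real.log N := by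
    have := mul_le_mul_of_nonneg_left h2 hβ.le
    rwa [mul_add, ← mul_assoc β (1 / β), mul_one_div_cancel hβ.ne', one_mul] at this
  have h5 : |β * Real.log c₁ + μ * Real.log L₀|
      ≤ |β * Real.log c₁ + μ * Real.log L₀| / Real.log 2 * Real.log N := by
    rw [div_mul_eq_mul_div, mul_div_assoc]
    exact le_mul_of_one_le_right (abs_nonneg _) (by rwa [le_div_iff₀ hl2, one_mul])
  have h6 := neg_abs_le (β * Real.log c₁ + μ * Real.log L₀)
  rw [add_mul]
  nlinarith [mul_le_mul_of_nonneg_left h3 hμ.le]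

/-! ### The error of the truncation method in terms of `δ` and `N` -/

/-- The tail is of order `D^{-α} L` and the noise of order `D^{-α} L^{1 - 1/s}`; negative powers of
`L₀` raise both to `D^{-α} L^{2 - 1/s}`. -/
lemma exists_truncation_bound_le {r : ℕ} (hr : 1 ≤ r) {s μ : ℝ} (hs : 1 ≤ s)
    (hμ : 2 * (r : ℝ) - 1 / s + 3 / 2 < μ) {p : ℝ≥0∞} (hp : 1 ≤ p)
    (hβ : 0 < μ - (1 / p).toReal + 1 / s) {L₀ : ℝ} (hL₀ : 0 < L₀) {a b : ℝ} (ha : 0 < a)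
    (hb : 0 < b) :
    ∃ C : ℝ, 0 < C ∧ ∀ (δ : ℝ) (n : ℕ), 0 < δ → δ < 1 → L₀ ≤ Real.log (1 / δ) →
      a * degreeScale s μ p δ ≤ n → n ≤ b * degreeScale s μ p δ →
      ((r * n : ℕ) : ℝ) ^ (-μ + 2 * r - 1 / s + 3 / 2) * (1 + Real.log (r * n : ℕ)) +
        δ * ((r * n : ℕ) : ℝ) ^ (2 * (r : ℝ) + 1 / 2) *
          ((r * n : ℕ) * (1 + Real.log (r * n : ℕ))) ^ (1 - (1 / p).toReal)
        ≤ C * upperRate r s μ p δ := by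
  obtain ⟨C₁, hC₁, hlog⟩ := exists_one_add_log_le hr hs hp hβ hL₀ hb
  have hu := toReal_one_div_le_one hp
  have hs1 : 1 / s ≤ 1 := by rw [div_le_one (by linarith)]; exact hs
  have hr1 : (1 : ℝ) ≤ r := by exact_mod_cast hr
  set u := (1 / p).toReal with hudef
  set α := μ - 2 * (r : ℝ) + 1 / s - 3 / 2 with hα
  have hα0 : 0 < α := by linarith
  set ν := 2 * (r : ℝ) + 1 / 2 with hν
  refine ⟨a ^ (-α) * C₁ * L₀ ^ (-(1 - 1 / s)) + (r * b) ^ ν * (r * b * C₁) ^ (1 - u) * L₀⁻¹,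
    by positivity, ?_⟩
  intro δ n h0 h1 hL hna hnb
  have hD := degreeScale_pos (s := s) (μ := μ) (p := p) h0 h1
  have hL0 := log_one_div_pos h0 h1
  have hn0 : (0 : ℝ) < n := (mul_pos ha hD).trans_le hna
  have hn : 1 ≤ n := by exact_mod_cast hn0
  have hl := hlog δ n h0 h1 hL hn hnb
  have hδ := mul_degreeScale_rpow hβ h0 h1
  rw [upperRate_eq h0 h1, ← hα]
  set D := degreeScale s μ p δ
  set L := Real.log (1 / δ)
  set X : ℝ := ((r * n : ℕ) : ℝ) with hX
  have hXn : (n : ℝ) ≤ X := by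
    rw [hX]; exact_mod_cast Nat.le_mul_of_pos_left n hr
  have hX1 : 1 ≤ X := le_trans (by exact_mod_cast hn) hXn
  have hlX := Real.log_nonneg hX1
  have hXD : X ≤ r * b * D := by
    rw [hX]; push_cast; rw [mul_assoc]; gcongr
  have hfirst : X ^ (-μ + 2 * r - 1 / s + 3 / 2) * (1 + Real.log X)
      ≤ a ^ (-α) * C₁ * L₀ ^ (-(1 - 1 / s)) * (D ^ (-α) * L ^ (2 - 1 / s)) := by
    have e1 : X ^ (-μ + 2 * r - 1 / s + 3 / 2) ≤ a ^ (-α) * D ^ (-α) := by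
      rw [show -μ + 2 * (r : ℝ) - 1 / s + 3 / 2 = -α by rw [hα]; ring,
        ← Real.mul_rpow ha.le hD.le]
      exact Real.rpow_le_rpow_of_nonpos (by positivity) (hna.trans hXn) (by linarith)
    have e2 : L ≤ L₀ ^ (-(1 - 1 / s)) * L ^ (2 - 1 / s) := by
      calc L = L ^ (-(1 - 1 / s)) * L ^ (2 - 1 / s) := by
            rw [← Real.rpow_add hL0, show -(1 - 1 / s) + (2 - 1 / s) = 1 by ring, Real.rpow_one]
        _ ≤ _ := by
            refine mul_le_mul_of_nonneg_right ?_ (by positivity)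
            exact Real.rpow_le_rpow_of_nonpos hL₀ hL (by linarith)
    calc _ ≤ a ^ (-α) * D ^ (-α) * (C₁ * (L₀ ^ (-(1 - 1 / s)) * L ^ (2 - 1 / s))) := by
          gcongr
          exact hl.trans (by gcongr)
      _ = _ := by ring
  have hsecond : δ * X ^ ν * (X * (1 + Real.log X)) ^ (1 - u)
      ≤ (r * b) ^ ν * (r * b * C₁) ^ (1 - u) * L₀⁻¹ * (D ^ (-α) * L ^ (2 - 1 / s)) := by
    have e1 : δ * D ^ (ν + (1 - u)) = D ^ (-α) * L ^ (u - 1 / s) := by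
      rw [← hδ, mul_left_comm, ← Real.rpow_add hD]
      congr 2
      rw [hα, hν]; ring
    have e2 : L ^ (1 - 1 / s) ≤ L₀⁻¹ * L ^ (2 - 1 / s) := by
      rw [show (2 : ℝ) - 1 / s = 1 + (1 - 1 / s) by ring, Real.rpow_add hL0, Real.rpow_one,
        ← mul_assoc]
      refine le_mul_of_one_le_left (by positivity) ?_
      rw [inv_mul_eq_div, le_div_iff₀ hL₀, one_mul]
      exact hL
    calc _ ≤ δ * (r * b * D) ^ ν * (r * b * D * (C₁ * L)) ^ (1 - u) := by
          have : 0 ≤ 1 - u := by linarith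
          have : 0 ≤ ν := by positivity
          gcongr
      _ = (r * b) ^ ν * (r * b * C₁) ^ (1 - u) * (δ * D ^ (ν + (1 - u)) * L ^ (1 - u)) := by
          rw [show r * b * D * (C₁ * L) = r * b * C₁ * D * L by ring,
            Real.mul_rpow (by positivity) hL0.le, Real.mul_rpow (by positivity) hD.le,
            Real.mul_rpow (by positivity) hD.le, Real.rpow_add hD ν (1 - u)]
          ring
      _ = (r * b) ^ ν * (r * b * C₁) ^ (1 - u) * (D ^ (-α) * L ^ (1 - 1 / s)) := by
          rw [e1, mul_assoc (D ^ (-α)), ← Real.rpow_add hL0,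
            show u - 1 / s + (1 - u) = 1 - 1 / s by ring]
      _ ≤ (r * b) ^ ν * (r * b * C₁) ^ (1 - u) * (D ^ (-α) * (L₀⁻¹ * L ^ (2 - 1 / s))) := by
          gcongr
      _ = _ := by ring
  rw [add_mul]
  exact add_le_add hfirst hsecond

/-- From `N ≤ c₂ D L` one gets `D^{-α} ≤ c₂^α L^α N^{-α}`, and the logarithmic exponents add up to
`α + 2 - 1/s = μ - 2r + 1/2`. -/
lemma exists_upperRate_le {r : ℕ} {s μ : ℝ} (hs : 1 ≤ s)
    (hμ : 2 * (r : ℝ) - 1 / s + 3 / 2 < μ) {p : ℝ≥0∞}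
    (hβ : 0 < μ - (1 / p).toReal + 1 / s) {L₀ : ℝ} (hL₀ : 0 < L₀) {c₁ c₂ : ℝ} (hc₁ : 0 < c₁)
    (hc₂ : 0 < c₂) :
    ∃ C : ℝ, 0 < C ∧ ∀ (δ : ℝ) (N : ℕ), 0 < δ → δ < 1 → L₀ ≤ Real.log (1 / δ) → 2 ≤ N →
      c₁ * infoScale s μ p δ ≤ N → N ≤ c₂ * infoScale s μ p δ →
      upperRate r s μ p δ ≤ C * ((N : ℝ) ^ (-μ + 2 * r - 1 / s + 3 / 2) *
        Real.log N ^ (μ - 2 * r + 1 / 2)) := by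
  have hs1 : 1 / s ≤ 1 := by rw [div_le_one (by linarith)]; exact hs
  have hμ0 : 0 < μ := by
    have : (0 : ℝ) ≤ r := by positivity
    linarith
  obtain ⟨C₁, hC₁, hlog⟩ := exists_log_one_div_le hμ0 hβ hL₀ hc₁
  set α := μ - 2 * (r : ℝ) + 1 / s - 3 / 2 with hα
  have hα0 : 0 < α := by linarith
  refine ⟨c₂ ^ α * C₁ ^ (μ - 2 * r + 1 / 2), by positivity, ?_⟩
  intro δ N h0 h1 hL hN hN1 hN2
  have hl := hlog δ N h0 h1 hL hN hN1
  have hD := degreeScale_pos (s := s) (μ := μ) (p := p) h0 h1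
  have hL0 := log_one_div_pos h0 h1
  have hN0 : (0 : ℝ) < N := by exact_mod_cast (by omega : 0 < N)
  rw [infoScale_eq hβ h0 h1] at hN2
  rw [upperRate_eq h0 h1, ← hα]
  set D := degreeScale s μ p δ
  set L := Real.log (1 / δ)
  have hlN : 0 ≤ Real.log N := Real.log_nonneg (by exact_mod_cast (by omega : 1 ≤ N))
  have e1 : D ^ (-α) ≤ c₂ ^ α * L ^ α * (N : ℝ) ^ (-α) := by
    have h2 : (c₂ * (D * L)) ^ (-α) ≤ (N : ℝ) ^ (-α) :=
      Real.rpow_le_rpow_of_nonpos hN0 hN2 (by linarith)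
    rw [Real.mul_rpow hc₂.le (by positivity), Real.mul_rpow hD.le hL0.le] at h2
    calc D ^ (-α) = c₂ ^ α * L ^ α * (c₂ ^ (-α) * (D ^ (-α) * L ^ (-α))) := by
          rw [Real.rpow_neg hc₂.le, Real.rpow_neg hL0.le]
          have : c₂ ^ α ≠ 0 := by positivity
          have : L ^ α ≠ 0 := by positivity
          field_simp
      _ ≤ _ := by gcongr
  calc D ^ (-α) * L ^ (2 - 1 / s)
      ≤ c₂ ^ α * L ^ α * (N : ℝ) ^ (-α) * L ^ (2 - 1 / s) := by gcongr
    _ = c₂ ^ α * (N : ℝ) ^ (-α) * L ^ (μ - 2 * r + 1 / 2) := by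
        rw [show μ - 2 * (r : ℝ) + 1 / 2 = α + (2 - 1 / s) by rw [hα]; ring,
          Real.rpow_add hL0]
        ring
    _ ≤ c₂ ^ α * (N : ℝ) ^ (-α) * (C₁ * Real.log N) ^ (μ - 2 * r + 1 / 2) := by
        have : 0 ≤ μ - 2 * (r : ℝ) + 1 / 2 := by linarith
        gcongr
    _ = _ := by
        rw [Real.mul_rpow hC₁.le hlN,
          show -μ + 2 * (r : ℝ) - 1 / s + 3 / 2 = -α by rw [hα]; ring]
        ring

lemma exists_card_hyperbolicCross_le {r : ℕ} (hr : 1 ≤ r) {s μ : ℝ} (hs : 1 ≤ s)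
    {p : ℝ≥0∞} (hp : 1 ≤ p)
    (hβ : 0 < μ - (1 / p).toReal + 1 / s) {L₀ : ℝ} (hL₀ : 0 < L₀) {c₁ : ℝ} (hc₁ : 0 < c₁) :
    ∃ a b : ℝ, 0 < a ∧ 0 < b ∧ ∀ (δ : ℝ) (N : ℕ), 0 < δ → δ < 1 → L₀ ≤ Real.log (1 / δ) →
      c₁ * infoScale s μ p δ ≤ N → ∃ n : ℕ, a * degreeScale s μ p δ ≤ n ∧
        n ≤ b * degreeScale s μ p δ ∧ (hyperbolicCross r n).card ≤ N := by
  obtain ⟨C, hC, hlog⟩ := exists_one_add_log_le hr hs hp hβ hL₀ two_pos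
  have hr0 : (0 : ℝ) < r := by exact_mod_cast hr
  set D₀ := min 1 L₀ ^ (1 / (μ - (1 / p).toReal + 1 / s)) with hD₀
  have hD₀0 : 0 < D₀ := by positivity
  -- The second entry makes `r n (1 + ln (r n)) ≤ c₁ D L ≤ N` for `n ≤ 2 a D`; the first keeps `n ≤
  -- 2 D`, the range in which `hlog` applies.
  set a := min 1 (c₁ / (2 * r * C)) with ha
  have ha0 : 0 < a := by positivity
  have ha1 : a ≤ 1 := min_le_left _ _
  have ha2 : a * (2 * r * C) ≤ c₁ := (le_div_iff₀ (by positivity)).1 (min_le_right _ _)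
  refine ⟨a, a + D₀⁻¹, ha0, by positivity, fun δ N h0 h1 hL hN => ?_⟩
  have hD := degreeScale_pos (s := s) (μ := μ) (p := p) h0 h1
  have hL0 := log_one_div_pos h0 h1
  have hDD := le_degreeScale hs hp hβ hL₀ h0 h1 hL
  rw [← hD₀] at hDD
  rw [infoScale_eq hβ h0 h1] at hN
  have hl := hlog δ
  set D := degreeScale s μ p δ
  set L := Real.log (1 / δ)
  have hceil := (Nat.ceil_lt_add_one (mul_pos ha0 hD).le).le
  refine ⟨⌈a * D⌉₊, Nat.le_ceil _, ?_, ?_⟩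
  · rw [add_mul]
    refine hceil.trans (add_le_add le_rfl ?_)
    rwa [inv_mul_eq_div, le_div_iff₀ hD₀0, one_mul]
  · have hn : 1 ≤ ⌈a * D⌉₊ := Nat.one_le_ceil_iff.2 (mul_pos ha0 hD)
    rcases le_or_gt (a * D) 1 with h | h
    -- Here `⌈a D⌉ ≤ 2 a D` may fail, but the cross of order `1` is empty: `kj ≥ r` contradicts `kj
    -- < r`.
    · have hn1 : ⌈a * D⌉₊ = 1 := le_antisymm (Nat.ceil_le.2 (by simpa using h)) hn
      have hempty : hyperbolicCross r 1 = ∅ := by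
        refine Finset.eq_empty_of_forall_notMem fun q hq => ?_
        obtain ⟨h1, h2, h3⟩ := mem_hyperbolicCross.1 hq
        exact absurd (Nat.mul_le_mul h1 (hr.trans h2)) (not_le.2 h3)
      rw [hn1, hempty, Finset.card_empty]
      exact Nat.zero_le _
    · have hn2 : (⌈a * D⌉₊ : ℝ) ≤ 2 * (a * D) := by linarith
      have hn3 : (⌈a * D⌉₊ : ℝ) ≤ 2 * D := hn2.trans (by nlinarith)
      have hl' := hl ⌈a * D⌉₊ h0 h1 hL hn hn3
      have hX1 : (1 : ℝ) ≤ ((r * ⌈a * D⌉₊ : ℕ) : ℝ) := by exact_mod_cast Nat.mul_pos hr hn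
      have := Real.log_nonneg hX1
      have hcard : ((hyperbolicCross r ⌈a * D⌉₊).card : ℝ) ≤ N := by
        calc _ ≤ ((r * ⌈a * D⌉₊ : ℕ) : ℝ) * (1 + Real.log (r * ⌈a * D⌉₊ : ℕ)) :=
              card_hyperbolicCross_le hr
          _ ≤ (r * (2 * (a * D))) * (C * L) := by
              refine mul_le_mul ?_ hl' (by linarith) (by positivity)
              rw [Nat.cast_mul]
              gcongr
          _ = a * (2 * r * C) * (D * L) := by ring
          _ ≤ c₁ * (D * L) := by gcongr
          _ ≤ N := hN
      exact_mod_cast hcard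

end GalerkinDiff

/-! ### ### Assembly of the two-sided estimates -/

theorem theorem3 (r : ℕ) (hr : 1 ≤ r) (s μ : ℝ) (hs : 1 ≤ s)
    (hμ : 2 * (r : ℝ) - 1 / s + 3 / 2 < μ) (p : ENNReal) (hp : 1 ≤ p) :
    -- The series for the derivative converges in `C(Q)` on the whole class.
    (∀ f ∈ GalerkinDiff.unitClass s μ, Summable (GalerkinDiff.derivTerm r f)) ∧
    ∀ c₁ c₂ : ℝ, 0 < c₁ → 0 < c₂ →
      -- The two-sided estimates of the minimal radius, in terms of `N` and in terms of `δ`.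
      (∃ c C : ℝ, 0 < c ∧ 0 < C ∧ ∀ (δ : ℝ) (N : ℕ), 0 < δ → δ < 1 → 2 ≤ N →
        c₁ * GalerkinDiff.infoScale s μ p δ ≤ N → N ≤ c₂ * GalerkinDiff.infoScale s μ p δ →
        ENNReal.ofReal (c * (N : ℝ) ^ (-μ + 2 * r - 1 / s + 3 / 2)) ≤
            GalerkinDiff.minimalRadius r s μ p N δ ∧
        GalerkinDiff.minimalRadius r s μ p N δ ≤
            ENNReal.ofReal (C * ((N : ℝ) ^ (-μ + 2 * r - 1 / s + 3 / 2) *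
              Real.log N ^ (μ - 2 * r + 1 / 2))) ∧
        ENNReal.ofReal (c * GalerkinDiff.lowerRate r s μ p δ) ≤
            GalerkinDiff.minimalRadius r s μ p N δ ∧
        GalerkinDiff.minimalRadius r s μ p N δ ≤
            ENNReal.ofReal (C * GalerkinDiff.upperRate r s μ p δ)) ∧
      -- The truncation method of a suitable order `n` uses at most `N` coefficients.
      (∃ a b : ℝ, 0 < a ∧ 0 < b ∧ ∀ (δ : ℝ) (N : ℕ), 0 < δ → δ < 1 → 2 ≤ N →
        c₁ * GalerkinDiff.infoScale s μ p δ ≤ N → N ≤ c₂ * GalerkinDiff.infoScale s μ p δ →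
        ∃ n : ℕ, a * GalerkinDiff.degreeScale s μ p δ ≤ n ∧
          n ≤ b * GalerkinDiff.degreeScale s μ p δ ∧
          (GalerkinDiff.hyperbolicCross r n).card ≤ N) ∧
      -- For every choice of `n` of this order the truncation method attains the upper bounds.
      (∀ a b : ℝ, 0 < a → 0 < b → ∃ C : ℝ, 0 < C ∧ ∀ (δ : ℝ) (N n : ℕ),
        0 < δ → δ < 1 → 2 ≤ N →
        c₁ * GalerkinDiff.infoScale s μ p δ ≤ N → N ≤ c₂ * GalerkinDiff.infoScale s μ p δ →
        a * GalerkinDiff.degreeScale s μ p δ ≤ n → n ≤ b * GalerkinDiff.degreeScale s μ p δ →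
        GalerkinDiff.algError r s μ p δ (GalerkinDiff.hyperbolicCross r n)
            (GalerkinDiff.truncation r n) ≤
          ENNReal.ofReal (C * ((N : ℝ) ^ (-μ + 2 * r - 1 / s + 3 / 2) *
            Real.log N ^ (μ - 2 * r + 1 / 2))) ∧
        GalerkinDiff.algError r s μ p δ (GalerkinDiff.hyperbolicCross r n)
            (GalerkinDiff.truncation r n) ≤
          ENNReal.ofReal (C * GalerkinDiff.upperRate r s μ p δ)) := by
  have hs1 : 1 / s ≤ 1 := by rw [div_le_one (by linarith)]; exact hs
  have hs0 : 0 < 1 / s := by positivity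
  have hr1 : (1 : ℝ) ≤ r := by exact_mod_cast hr
  have hu := GalerkinDiff.toReal_one_div_le_one hp
  have hμ0 : 0 < μ := by linarith
  have hβ : 0 < μ - (1 / p).toReal + 1 / s := by linarith
  refine ⟨fun f hf => GalerkinDiff.summable_derivTerm hr hs hμ hf, fun c₁ c₂ hc₁ hc₂ => ?_⟩
  -- The condition `2 ≤ N ≤ c₂ infoScale` keeps `δ` away from `1`, where `ln (1/δ)` would
  -- degenerate.
  obtain ⟨L₀, hL₀, hL⟩ := GalerkinDiff.exists_le_log_of_le_infoScale (s := s) hμ0 hβ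
    (div_pos two_pos hc₂)
  replace hL : ∀ (δ : ℝ) (N : ℕ), 0 < δ → δ < 1 → 2 ≤ N →
      N ≤ c₂ * GalerkinDiff.infoScale s μ p δ → L₀ ≤ Real.log (1 / δ) := by
    intro δ N h0 h1 hN hle
    refine hL δ h0 h1 ?_
    rw [div_le_iff₀ hc₂, mul_comm]
    exact le_trans (by exact_mod_cast hN) hle
  obtain ⟨a₀, b₀, ha₀, hb₀, hcard⟩ :=
    GalerkinDiff.exists_card_hyperbolicCross_le hr hs hp hβ hL₀ hc₁
  obtain ⟨K, hK, hKle⟩ := GalerkinDiff.exists_upperRate_le hs hμ hβ hL₀ hc₁ hc₂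
  obtain ⟨C₀, hC₀, herr⟩ := GalerkinDiff.exists_algError_truncation_le hr hs hμ hp
  have htrunc : ∀ a b : ℝ, 0 < a → 0 < b → ∃ C : ℝ, 0 < C ∧ ∀ (δ : ℝ) (N n : ℕ),
      0 < δ → δ < 1 → 2 ≤ N →
      c₁ * GalerkinDiff.infoScale s μ p δ ≤ N → N ≤ c₂ * GalerkinDiff.infoScale s μ p δ →
      a * GalerkinDiff.degreeScale s μ p δ ≤ n → n ≤ b * GalerkinDiff.degreeScale s μ p δ →
      GalerkinDiff.algError r s μ p δ (GalerkinDiff.hyperbolicCross r n)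
          (GalerkinDiff.truncation r n) ≤
        ENNReal.ofReal (C * ((N : ℝ) ^ (-μ + 2 * r - 1 / s + 3 / 2) *
          Real.log N ^ (μ - 2 * r + 1 / 2))) ∧
      GalerkinDiff.algError r s μ p δ (GalerkinDiff.hyperbolicCross r n)
          (GalerkinDiff.truncation r n) ≤
        ENNReal.ofReal (C * GalerkinDiff.upperRate r s μ p δ) := by
    intro a b ha hb
    obtain ⟨C₁, hC₁, hbound⟩ :=
      GalerkinDiff.exists_truncation_bound_le hr hs hμ hp hβ hL₀ ha hb
    refine ⟨C₀ * C₁ * (K + 1), by positivity, fun δ N n h0 h1 hN hN1 hN2 hna hnb => ?_⟩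
    have hLδ := hL δ N h0 h1 hN hN2
    have hpos := GalerkinDiff.log_one_div_pos h0 h1
    have hU : 0 ≤ GalerkinDiff.upperRate r s μ p δ := by
      rw [GalerkinDiff.upperRate]; positivity
    have hlogN : 0 ≤ Real.log N := Real.log_nonneg (by exact_mod_cast (by omega : 1 ≤ N))
    have hn : 1 ≤ n := by
      have := (mul_pos ha (GalerkinDiff.degreeScale_pos (s := s) (μ := μ) (p := p) h0 h1)).trans_le
        hna
      exact_mod_cast this
    have hle := mul_le_mul_of_nonneg_left (hbound δ n h0 h1 hLδ hna hnb) hC₀.le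
    refine ⟨(herr δ n h0 hn).trans (ENNReal.ofReal_le_ofReal (hle.trans ?_)),
      (herr δ n h0 hn).trans (ENNReal.ofReal_le_ofReal (hle.trans ?_))⟩
    · rw [← mul_assoc, mul_assoc (C₀ * C₁)]
      refine mul_le_mul_of_nonneg_left ((hKle δ N h0 h1 hLδ hN hN1 hN2).trans ?_) (by positivity)
      refine mul_le_mul_of_nonneg_right (by linarith) (by positivity)
    · rw [← mul_assoc, mul_assoc (C₀ * C₁)]
      exact mul_le_mul_of_nonneg_left (le_mul_of_one_le_left hU (by linarith)) (by positivity)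
  refine ⟨?_, ⟨a₀, b₀, ha₀, hb₀, fun δ N h0 h1 hN hN1 hN2 =>
    hcard δ N h0 h1 (hL δ N h0 h1 hN hN2) hN1⟩, htrunc⟩
  obtain ⟨C, hC, hupper⟩ := htrunc a₀ b₀ ha₀ hb₀
  obtain ⟨c, hc, hlower⟩ := GalerkinDiff.exists_le_minimalRadius hr hs hμ0.le p
  set α := μ - 2 * (r : ℝ) + 1 / s - 3 / 2 with hα
  have hexp : -μ + 2 * (r : ℝ) - 1 / s + 3 / 2 = -α := by rw [hα]; ring
  have hα0 : 0 < α := by linarith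
  -- The minimum serves both lower bounds: `N ≤ c₂ infoScale` gives `N^{-α} ≥ c₂^{-α}
  -- infoScale^{-α}`, and `infoScale^{-α}` is `lowerRate`.
  refine ⟨c * min 1 (c₂ ^ (-α)), C, by positivity, hC, fun δ N h0 h1 hN hN1 hN2 => ?_⟩
  obtain ⟨n, hna, hnb, hnN⟩ := hcard δ N h0 h1 (hL δ N h0 h1 hN hN2) hN1
  have hlow := hlower δ N h0.le (by omega)
  have hmin : GalerkinDiff.minimalRadius r s μ p N δ ≤
      GalerkinDiff.algError r s μ p δ (GalerkinDiff.hyperbolicCross r n)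
        (GalerkinDiff.truncation r n) := by
    refine iInf₂_le_of_le (GalerkinDiff.hyperbolicCross r n) ⟨fun q hq => ?_, hnN⟩ (iInf_le _ _)
    have := GalerkinDiff.mem_hyperbolicCross.1 hq
    exact ⟨this.1, this.2.1⟩
  have hup := hupper δ N n h0 h1 hN hN1 hN2 hna hnb
  have hI := GalerkinDiff.infoScale_pos (s := s) (μ := μ) (p := p) h0 h1
  have hN0 : (0 : ℝ) < N := by exact_mod_cast (by omega : 0 < N)
  refine ⟨le_trans (ENNReal.ofReal_le_ofReal ?_) hlow, hmin.trans hup.1,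
    le_trans (ENNReal.ofReal_le_ofReal ?_) hlow, hmin.trans hup.2⟩
  · rw [mul_assoc]
    refine mul_le_mul_of_nonneg_left (mul_le_of_le_one_left (by positivity) (min_le_left _ _))
      hc.le
  · rw [GalerkinDiff.lowerRate_eq h0 h1, mul_assoc, hexp]
    refine mul_le_mul_of_nonneg_left ?_ hc.le
    calc _ ≤ c₂ ^ (-α) * GalerkinDiff.infoScale s μ p δ ^ (-α) := by
          gcongr
          exact min_le_right _ _
      _ = (c₂ * GalerkinDiff.infoScale s μ p δ) ^ (-α) := (Real.mul_rpow hc₂.le hI.le).symm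
      _ ≤ (N : ℝ) ^ (-α) := Real.rpow_le_rpow_of_nonpos hN0 hN2 (by linarith)
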